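/- Let $(\mathbb X,dx)$ be a $\sigma$-finite measure space, $\mathbb V$ a finite dimensional real inner product space, $\mathscr L^2_+$ a closed subspace of $\mathscr L^2(\mathbb X,\mathbb V)$ and $\Pi$ the orthogonal projection of $\mathscr L^2(\mathbb X,\mathbb V)$ onto $\mathscr L^2_+$. Let $1\le s_1<2<s_\infty\le\infty$ and assume that for every $s\in(s_1,s_\infty)$ the operator $\Pi$, restricted to $\mathscr L^2\cap\mathscr L^s$, extends to a continuous linear operator of $\mathscr L^s(\mathbb X,\mathbb V)$ into itself. Fix $p\in(s_1,s_\infty)$, let $\mathscr L^p_+$ be the closure of $\mathscr L^2_+\cap\mathscr L^p$ in $\mathscr L^p(\mathbb X,\mathbb V)$, and for $\mathfrak f\in\mathscr L^p(\mathbb X,\mathbb V)$ let $\mathfrak R_p\mathfrak f$ be the point of $\mathscr L^p_+$ nearest to $\mathfrak f$ in the $\mathscr L^p$-distance (it exists and is unique, since $1<p<\infty$). Let $s_1\le r_1<r_2\le s_\infty$ and suppose that $\mathfrak R_p$ maps $\mathscr L^{r_i}$ into weak $\mathscr L^{r_i}$ for $i=1,2$, that is, for each $i$ there is a constant $C_i$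 such that $$\operatorname{meas}\{x\in\mathbb X : |\mathfrak R_p\mathfrak f(x)|>t\}\le C_i\,t^{-r_i}\int_{\mathbb X}|\mathfrak f(x)|^{r_i}\,dx\qquad\text{for all } t>0 \text{ and all } \mathfrak f\in\mathscr L^p\cap\mathscr L^{r_i}$$ (when $r_2=\infty$ this condition for $i=2$ is read as $\|\mathfrak R_p\mathfrak f\|_\infty\le C_2\|\mathfrak f\|_\infty$ for all $\mathfrak f\in\mathscr L^p\cap\mathscr L^\infty$). Then for every $r\in(r_1,r_2)$ there is a constant $C_r$ such that $$\int_{\mathbb X}|\mathfrak R_p\mathfrak f(x)|^r\,dx\le C_r\int_{\mathbb X}|\mathfrak f(x)|^r\,dx\qquad\text{for all } \mathfrak f\in\mathscr L^p(\mathbb X,\mathbb V)\cap\mathscr L^r(\mathbb X,\mathbb V).$$ -/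

import Mathlib

open MeasureTheory
open scoped ENNReal NNReal

namespace LpProjection

variable {X : Type*} [MeasurableSpace X] {μ : Measure X}
  {V : Type*} [NormedAddCommGroup V] [InnerProductSpace ℝ V]

/-- The orthogonal projection `Π` of `L²(X, V)` onto a closed subspace `M = L²₊`. -/
noncomputable def l2Proj [FiniteDimensional ℝ V]
    (M : Submodule ℝ (Lp V 2 μ)) (hM : IsClosed (M : Set (Lp V 2 μ))) :
    Lp V 2 μ →L[ℝ] Lp V 2 μ :=
  haveI : CompleteSpace V := FiniteDimensional.complete ℝ V
  haveI : CompleteSpace M := hM.completeSpace_coe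
  M.starProjection

/-- A continuous linear operator `P` on `L²(X, V)` extends to a continuous linear operator on
`L^s(X, V)`: some continuous linear `T` on `L^s` agrees with `P` on `L² ∩ L^s`. -/
def ExtendsToLp (P : Lp V 2 μ →L[ℝ] Lp V 2 μ) (s : ℝ≥0∞) [Fact (1 ≤ s)] : Prop :=
  ∃ T : Lp V s μ →L[ℝ] Lp V s μ, ∀ (f : Lp V 2 μ) (g : Lp V s μ),
    f =ᵐ[μ] g → P f =ᵐ[μ] T g

/-- The subspace `L²₊ ∩ L^p` of `L^p(X, V)`. -/
noncomputable def interLp (M : Submodule ℝ (Lp V 2 μ)) (p : ℝ≥0∞) : Submodule ℝ (Lp V p μ) where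
  carrier := {g | ∃ f ∈ M, f =ᵐ[μ] g}
  zero_mem' := ⟨0, M.zero_mem, (Lp.coeFn_zero V 2 μ).trans (Lp.coeFn_zero V p μ).symm⟩
  add_mem' := by
    rintro a b ⟨f, hf, hfa⟩ ⟨g, hg, hgb⟩
    exact ⟨f + g, M.add_mem hf hg,
      (Lp.coeFn_add f g).trans ((hfa.add hgb).trans (Lp.coeFn_add a b).symm)⟩
  smul_mem' := by
    rintro c a ⟨f, hf, hfa⟩
    exact ⟨c • f, M.smul_mem c hf,
      (Lp.coeFn_smul c f).trans ((hfa.const_smul c).trans (Lp.coeFn_smul c a).symm)⟩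

/-- `L^p₊`, the closure of `L²₊ ∩ L^p` in `L^p(X, V)`. -/
noncomputable def lpPlus (M : Submodule ℝ (Lp V 2 μ)) (p : ℝ≥0∞) [Fact (1 ≤ p)] :
    Submodule ℝ (Lp V p μ) :=
  (interLp M p).topologicalClosure

/-- `α` is a point of `L^p₊` nearest to `f` in the `L^p` distance. -/
def IsNearest (M : Submodule ℝ (Lp V 2 μ)) (p : ℝ≥0∞) [Fact (1 ≤ p)]
    (f α : Lp V p μ) : Prop :=
  α ∈ lpPlus M p ∧ ∀ γ ∈ lpPlus M p, ‖f - α‖ ≤ ‖f - γ‖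

open Classical in
/-- The nonlinear `L^p` projection `ℜ_p`, sending `f` to its nearest point in `L^p₊`. For
`1 < p < ∞` that point exists and is unique, so that the value `0` of the other branch is
never taken. -/
noncomputable def lpProj (M : Submodule ℝ (Lp V 2 μ)) (p : ℝ≥0∞) [Fact (1 ≤ p)]
    (f : Lp V p μ) : Lp V p μ :=
  if h : ∃ α, IsNearest M p f α then h.choose else 0

/-- `R`, defined on `L^p`, maps `L^r` into weak `L^r`: one constant `C` serves all
`f ∈ L^p ∩ L^r` and all levels `t > 0`. For `r = ∞`, where weak `L^∞` is `L^∞`, this reads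
`‖R f‖_∞ ≤ C ‖f‖_∞`. -/
def WeakType {p : ℝ≥0∞} (R : Lp V p μ → Lp V p μ) (r : ℝ≥0∞) : Prop :=
  ∃ C : ℝ≥0, ∀ f : Lp V p μ, MemLp f r μ →
    if r = ∞ then eLpNorm (R f) ∞ μ ≤ C * eLpNorm f ∞ μ
    else ∀ t : ℝ≥0, 0 < t →
      μ {x | t < ‖R f x‖₊} ≤ C * (t : ℝ≥0∞) ^ (-r.toReal) * ∫⁻ x, ‖f x‖ₑ ^ r.toReal ∂μ

end LpProjection

/-! `ℜ_p` is not sublinear, so Marcinkiewicz's splitting of `f` into a high and a low part cannot be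
applied to it directly. The substitute is the Euler equation of the nearest point. Write `J v =
|v|^(p-2) v` (`powDual`). The residual `h = f - ℜ_p f` satisfies `∫⟨J h, γ⟩ = 0` for every `γ` in
`L^p₊` (`IsNearest.integral_inner_eq_zero`).

Let `g = f 1_{Sᶜ}` be a truncation with residual `k`, and let `e = f 1_S`. Then `e - (h - k) = ℜ_p f
- ℜ_p g` lies in `L^p₊`, so `∫⟨J h - J k, h - k⟩ = ∫⟨J h - J k, e⟩`. The left integrand is
nonnegative and controls `|h|^p` where `|h| > 2|k|`; the right one lives on `S`. Absorbing the cross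
terms bounds `∫ |h|^p` over `{|h| > 2|k|}` by a multiple of `∫_S |f|^p + ∫_B |k|^p`, where `B` is
the part of `S` on which `|k| ≤ 2|h|` and `|f| < |k|` (`exists_residual_comparison`).

By Chebyshev this bounds `μ{|h| > l}` up to the term `μ{|k| > l/2}`. The set `S` is then chosen,
depending on `l`, so that the weak type hypothesis at an exponent `s` controls both terms in `k`. If
`p < s < ∞`, take `S = {|f| > l/2}`, so that `|k| > l/2` on `B`. If `s = ∞`, take `S = {|f| > δl}`
with `δ` so small that `|k| ≤ l/2`. If `s < p`, take `S = {|f| ≤ δl, |h| ≤ l}`, so that `|k| ≤ 2l`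
on `B`; then `μ{|h| > l}` reappears on the right with a factor `δ^s`, and is absorbed for small `δ`.

The outcome is a bound of `μ{|h| > l}` by truncated moments of `f` of orders `p` and `s` (of order
`p` alone if `s = ∞`). Since `r` lies strictly between `p` and `s`, integration in `l` bounds the
`r`-th moment of `h`, hence that of `ℜ_p f = f - h`. For `r = p` it suffices to compare with the
point `0` of `L^p₊`. -/

namespace LpProjection

/-! ### Uniform convexity of `|·|^P` -/

section Pointwise

variable {V : Type*} [NormedAddCommGroup V] [InnerProductSpace ℝ V]

/-- If the norms agree, strict convexity of the Euclidean norm makes the inequality strict;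
otherwise strict convexity of `t ↦ t ^ P` does. -/
theorem norm_midpoint_rpow_lt {P : ℝ} (hP : 1 < P) {a b : V} (hab : a ≠ b) :
    ‖(1 / 2 : ℝ) • (a + b)‖ ^ P < (‖a‖ ^ P + ‖b‖ ^ P) / 2 := by
  have hn : ‖(1 / 2 : ℝ) • (a + b)‖ = ‖a + b‖ / 2 := by
    rw [norm_smul]; norm_num; ring
  have h1 : ‖a + b‖ ≤ ‖a‖ + ‖b‖ := norm_add_le a b
  have hP0 : 0 < P := by linarith
  rw [hn]
  by_cases hne : ‖a‖ = ‖b‖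
  · have h2 : ‖a + b‖ ≠ ‖a‖ + ‖b‖ := fun h ↦ hab (eq_of_norm_eq_of_norm_add_eq hne h)
    have h3 : ‖a + b‖ / 2 < ‖b‖ := by
      have := lt_of_le_of_ne h1 h2
      linarith
    rw [hne, add_self_div_two]
    exact Real.rpow_lt_rpow (by positivity) h3 hP0
  · have h2 := (strictConvexOn_rpow hP).2 (Set.mem_Ici.2 (norm_nonneg a))
      (Set.mem_Ici.2 (norm_nonneg b)) hne (show (0 : ℝ) < 1 / 2 by norm_num)
      (show (0 : ℝ) < 1 / 2 by norm_num) (by norm_num)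
    simp only [smul_eq_mul] at h2
    have h3 : (‖a + b‖ / 2) ^ P ≤ (1 / 2 * ‖a‖ + 1 / 2 * ‖b‖) ^ P :=
      Real.rpow_le_rpow (by positivity) (by linarith) hP0.le
    linarith

/-- Uniform convexity of `‖·‖ ^ P` on a finite dimensional space, in a form that can be
integrated. -/
theorem exists_norm_sub_rpow_le [FiniteDimensional ℝ V] {P : ℝ} (hP : 1 < P) {ε : ℝ}
    (hε : 0 < ε) :
    ∃ C : ℝ, 0 ≤ C ∧ ∀ a b : V, ‖a - b‖ ^ P ≤ ε * (‖a‖ ^ P + ‖b‖ ^ P) +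
      C * ((‖a‖ ^ P + ‖b‖ ^ P) / 2 - ‖(1 / 2 : ℝ) • (a + b)‖ ^ P) := by
  have hP0 : 0 < P := by linarith
  have : ProperSpace V := FiniteDimensional.proper_real V
  let D : V × V → ℝ := fun z ↦ (‖z.1‖ ^ P + ‖z.2‖ ^ P) / 2 - ‖(1 / 2 : ℝ) • (z.1 + z.2)‖ ^ P
  have hrc : Continuous fun t : ℝ ↦ t ^ P := Real.continuous_rpow_const hP0.le
  have hDc : Continuous D := by
    have h1 : Continuous fun z : V × V ↦ ‖z.1‖ ^ P := hrc.comp (by fun_prop)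
    have h2 : Continuous fun z : V × V ↦ ‖z.2‖ ^ P := hrc.comp (by fun_prop)
    have h3 : Continuous fun z : V × V ↦ ‖(1 / 2 : ℝ) • (z.1 + z.2)‖ ^ P :=
      hrc.comp (by fun_prop)
    exact ((h1.add h2).div_const 2).sub h3
  have hEc : Continuous fun z : V × V ↦ ‖z.1 - z.2‖ ^ P := hrc.comp (by fun_prop)
  have hD0 : ∀ z, 0 ≤ D z := by
    intro z
    by_cases h : z.1 = z.2
    · have : (1 / 2 : ℝ) • (z.2 + z.2) = z.2 := by
        rw [← two_smul ℝ z.2, smul_smul]; norm_num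
      simp only [D, h, this]
      linarith
    · have := norm_midpoint_rpow_lt hP h
      simp only [D]; linarith
  -- By homogeneity it is enough to work on the unit sphere. Where `‖a - b‖ ^ P < ε` the first term
  -- will suffice; on the compact remainder the convexity defect `D` has a positive minimum.
  let K : Set (V × V) := Metric.sphere 0 1 ∩ {z | ε ≤ ‖z.1 - z.2‖ ^ P}
  have hK : IsCompact K :=
    (isCompact_sphere 0 1).inter_right (isClosed_le continuous_const hEc)
  obtain ⟨C, hC0, hC⟩ : ∃ C : ℝ, 0 ≤ C ∧ ∀ z ∈ K, ‖z.1 - z.2‖ ^ P ≤ C * D z := by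
    rcases K.eq_empty_or_nonempty with hKe | hKn
    · exact ⟨0, le_rfl, fun z hz ↦ by simp [hKe] at hz⟩
    · obtain ⟨z₀, hz₀, hmin⟩ := hK.exists_isMinOn hKn hDc.continuousOn
      have hpos : 0 < D z₀ := by
        have hne : z₀.1 ≠ z₀.2 := by
          intro h
          have := hz₀.2
          simp only [Set.mem_ofPred_eq, h, sub_self, norm_zero, Real.zero_rpow hP0.ne'] at this
          linarith
        have := norm_midpoint_rpow_lt hP hne
        simp only [D]; linarith
      refine ⟨2 ^ P / D z₀, by positivity, fun z hz ↦ ?_⟩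
      have h1 : ‖z‖ = 1 := by simpa using hz.1
      have h2 : ‖z.1 - z.2‖ ≤ 2 := by
        have := norm_sub_le z.1 z.2
        have := norm_fst_le z
        have := norm_snd_le z
        linarith
      have h3 : D z₀ ≤ D z := hmin hz
      calc ‖z.1 - z.2‖ ^ P ≤ 2 ^ P := Real.rpow_le_rpow (norm_nonneg _) h2 hP0.le
        _ = 2 ^ P / D z₀ * D z₀ := by field_simp
        _ ≤ 2 ^ P / D z₀ * D z := by gcongr
  refine ⟨C, hC0, fun a b ↦ ?_⟩
  by_cases hz : (a, b) = 0
  · obtain ⟨rfl, rfl⟩ := Prod.mk_eq_zero.1 hz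
    simp [Real.zero_rpow hP0.ne']
  set t : ℝ := ‖(a, b)‖ with ht
  have htpos : 0 < t := norm_pos_iff.2 hz
  let z : V × V := t⁻¹ • (a, b)
  have hz1 : ‖z‖ = 1 := by
    simp only [z, norm_smul, norm_inv, Real.norm_eq_abs, abs_of_pos htpos, ← ht]
    field_simp
  -- The norm of the product is the maximum, so one of the two components has norm one.
  have hmax : 1 ≤ ‖z.1‖ ^ P + ‖z.2‖ ^ P := by
    rw [Prod.norm_def] at hz1
    rcases max_choice ‖z.1‖ ‖z.2‖ with h | h <;> rw [h] at hz1 <;> rw [hz1, Real.one_rpow] <;>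
      linarith [Real.rpow_nonneg (norm_nonneg z.1) P, Real.rpow_nonneg (norm_nonneg z.2) P]
  have key : ‖z.1 - z.2‖ ^ P ≤ ε * (‖z.1‖ ^ P + ‖z.2‖ ^ P) + C * D z := by
    by_cases hzK : ε ≤ ‖z.1 - z.2‖ ^ P
    · have := hC z ⟨by simpa using hz1, hzK⟩
      nlinarith
    · have := mul_nonneg hC0 (hD0 z)
      nlinarith
  have hsc : ∀ v : V, ‖v‖ ^ P = t ^ P * ‖t⁻¹ • v‖ ^ P := by
    intro v
    rw [← Real.mul_rpow htpos.le (norm_nonneg _), norm_smul, norm_inv, Real.norm_eq_abs,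
      abs_of_pos htpos, mul_inv_cancel_left₀ htpos.ne']
  have e3 : t⁻¹ • (1 / 2 : ℝ) • (a + b) = (1 / 2 : ℝ) • (z.1 + z.2) := by
    simp only [z, Prod.smul_fst, Prod.smul_snd, ← smul_add]
    rw [smul_comm]
  have e4 : t⁻¹ • (a - b) = z.1 - z.2 := by simp [z, smul_sub]
  rw [hsc (a - b), hsc a, hsc b, hsc ((1 / 2 : ℝ) • (a + b)), e3, e4]
  have := mul_le_mul_of_nonneg_left key (Real.rpow_nonneg htpos.le P)
  simp only [D] at this
  calc _ ≤ _ := this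
    _ = _ := by simp only [z, Prod.smul_fst, Prod.smul_snd]; ring

end Pointwise

/-! ### Existence of the nearest point in `L^p₊` -/

section Nearest

variable {X : Type*} [MeasurableSpace X] {μ : Measure X}
  {V : Type*} [NormedAddCommGroup V] [InnerProductSpace ℝ V]
  {p : ℝ≥0∞} [Fact (1 ≤ p)]

omit [InnerProductSpace ℝ V] in
theorem norm_rpow_eq_integral (hp : p ≠ ∞) (f : Lp V p μ) :
    ‖f‖ ^ p.toReal = ∫ x, ‖f x‖ ^ p.toReal ∂μ := by
  have hp0 : p ≠ 0 := (zero_lt_one.trans_le Fact.out).ne'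
  have hpos : 0 < p.toReal := ENNReal.toReal_pos hp0 hp
  have hI : 0 ≤ ∫ x, ‖f x‖ ^ p.toReal ∂μ :=
    integral_nonneg fun x ↦ Real.rpow_nonneg (norm_nonneg _) _
  rw [Lp.norm_def, (Lp.memLp f).eLpNorm_eq_integral_rpow_norm hp0 hp,
    ENNReal.toReal_ofReal (Real.rpow_nonneg hI _), ← Real.rpow_mul hI,
    inv_mul_cancel₀ hpos.ne', Real.rpow_one]

omit [InnerProductSpace ℝ V] in
theorem integrable_norm_rpow (hp : p ≠ ∞) (f : Lp V p μ) :
    Integrable (fun x ↦ ‖f x‖ ^ p.toReal) μ :=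
  (Lp.memLp f).integrable_norm_rpow (zero_lt_one.trans_le Fact.out).ne' hp

theorem exists_lp_norm_sub_rpow_le [FiniteDimensional ℝ V] (hp1 : 1 < p) (hp : p ≠ ∞) {ε : ℝ}
    (hε : 0 < ε) :
    ∃ C : ℝ, 0 ≤ C ∧ ∀ a b : Lp V p μ, ‖a - b‖ ^ p.toReal ≤
      ε * (‖a‖ ^ p.toReal + ‖b‖ ^ p.toReal) +
      C * ((‖a‖ ^ p.toReal + ‖b‖ ^ p.toReal) / 2 - ‖(1 / 2 : ℝ) • (a + b)‖ ^ p.toReal) := by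
  have hP : 1 < p.toReal := by
    rwa [← ENNReal.toReal_one, ENNReal.toReal_lt_toReal ENNReal.one_ne_top hp]
  obtain ⟨C, hC0, hC⟩ := exists_norm_sub_rpow_le (V := V) hP hε
  refine ⟨C, hC0, fun a b ↦ ?_⟩
  simp only [norm_rpow_eq_integral hp]
  have ia := integrable_norm_rpow hp a
  have ib := integrable_norm_rpow hp b
  have im := integrable_norm_rpow hp ((1 / 2 : ℝ) • (a + b))
  have is : Integrable (fun x ↦ ‖a x‖ ^ p.toReal + ‖b x‖ ^ p.toReal) μ := ia.add ib
  have id : Integrable (fun x ↦ (‖a x‖ ^ p.toReal + ‖b x‖ ^ p.toReal) / 2 -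
      ‖((1 / 2 : ℝ) • (a + b) : Lp V p μ) x‖ ^ p.toReal) μ := (is.div_const 2).sub im
  rw [← integral_add ia ib, ← integral_div, ← integral_sub (is.div_const 2) im,
    ← integral_const_mul, ← integral_const_mul, ← integral_add (is.const_mul ε) (id.const_mul C)]
  refine integral_mono_ae (integrable_norm_rpow hp _) ((is.const_mul ε).add (id.const_mul C)) ?_
  filter_upwards [Lp.coeFn_sub a b, Lp.coeFn_add a b, Lp.coeFn_smul (1 / 2 : ℝ) (a + b)]
    with x h1 h2 h3
  simp only [h1, h3, Pi.sub_apply, Pi.smul_apply, h2, Pi.add_apply]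
  exact hC (a x) (b x)

theorem exists_isNearest [FiniteDimensional ℝ V] (M : Submodule ℝ (Lp V 2 μ)) (hp1 : 1 < p)
    (hp : p ≠ ∞) (f : Lp V p μ) : ∃ α, IsNearest M p f α := by
  have : CompleteSpace V := FiniteDimensional.complete ℝ V
  have hp0 : p ≠ 0 := (zero_lt_one.trans hp1).ne'
  set P := p.toReal with hPdef
  have hP0 : 0 < P := ENNReal.toReal_pos hp0 hp
  set K : Set (Lp V p μ) := (lpPlus M p : Set (Lp V p μ)) with hKdef
  have hKn : K.Nonempty := ⟨0, (lpPlus M p).zero_mem⟩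
  have hKc : IsClosed K := Submodule.isClosed_topologicalClosure _
  set d := Metric.infDist f K with hd
  have hd0 : 0 ≤ d := Metric.infDist_nonneg
  have hex : ∀ n : ℕ, ∃ y ∈ K, dist f y < d + 1 / (n + 1 : ℝ) := fun n ↦
    (Metric.infDist_lt_iff hKn).1 (by
      have : (0 : ℝ) < 1 / (n + 1 : ℝ) := by positivity
      linarith)
  choose y hyK hyd using hex
  have hlow : ∀ γ ∈ K, d ≤ ‖f - γ‖ := fun γ hγ ↦ by
    rw [← dist_eq_norm]; exact Metric.infDist_le_dist_of_mem hγ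
  have hupto : Filter.Tendsto (fun n : ℕ ↦ d + 1 / (n + 1 : ℝ)) Filter.atTop (nhds d) := by
    simpa using tendsto_one_div_add_atTop_nhds_zero_nat.const_add d
  have hlim : Filter.Tendsto (fun n ↦ ‖f - y n‖) Filter.atTop (nhds d) :=
    tendsto_of_tendsto_of_tendsto_of_le_of_le tendsto_const_nhds hupto
      (fun n ↦ hlow _ (hyK n)) (fun n ↦ by simpa [dist_eq_norm] using (hyd n).le)
  have hlimP : Filter.Tendsto (fun n ↦ ‖f - y n‖ ^ P) Filter.atTop (nhds (d ^ P)) :=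
    hlim.rpow_const (Or.inr hP0.le)
  have hcau : CauchySeq y := by
    rw [Metric.cauchySeq_iff]
    intro η hη
    have hηP : 0 < η ^ P := Real.rpow_pos_of_pos hη P
    have hdP : 0 ≤ d ^ P := Real.rpow_nonneg hd0 P
    -- `ε` and `δ` are tuned so that, once `‖f - y n‖ ^ P < d ^ P + δ`, the two terms of the uniform
    -- convexity bound are at most `η ^ P / 2` and `η ^ P / 4`.
    set ε := η ^ P / (4 * (d ^ P + 1)) with hε
    have hεpos : 0 < ε := by positivity
    obtain ⟨C, hC0, hC⟩ := exists_lp_norm_sub_rpow_le (V := V) (μ := μ) hp1 hp hεpos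
    set δ := min 1 (η ^ P / (4 * (C + 1))) with hδ
    have hδpos : 0 < δ := lt_min one_pos (by positivity)
    obtain ⟨N, hN⟩ := Filter.eventually_atTop.1
      (hlimP.eventually (gt_mem_nhds (show d ^ P < d ^ P + δ by linarith)))
    refine ⟨N, fun m hm n hn ↦ ?_⟩
    have h1 := hC (f - y m) (f - y n)
    have e1 : f - y m - (f - y n) = y n - y m := by abel
    have e2 : (1 / 2 : ℝ) • (f - y m + (f - y n)) = f - (1 / 2 : ℝ) • (y m + y n) := by
      rw [show f - y m + (f - y n) = (2 : ℝ) • f - (y m + y n) by rw [two_smul]; abel,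
        smul_sub, smul_smul]
      norm_num
    rw [e1, e2] at h1
    -- The midpoint of two points of `L^p₊` is again a competitor.
    have h2 : d ^ P ≤ ‖f - (1 / 2 : ℝ) • (y m + y n)‖ ^ P :=
      Real.rpow_le_rpow hd0 (hlow _ ((lpPlus M p).smul_mem _
        ((lpPlus M p).add_mem (hyK m) (hyK n)))) hP0.le
    have h3 := hN m hm
    have h4 := hN n hn
    have hδ1 : δ ≤ 1 := min_le_left _ _
    have hδ2 : C * δ ≤ η ^ P / 4 := by
      have : C * δ ≤ C * (η ^ P / (4 * (C + 1))) := by gcongr; exact min_le_right _ _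
      refine this.trans ?_
      rw [← mul_div_assoc, div_le_div_iff₀ (by positivity) (by positivity)]
      nlinarith
    have h5 : ε * (‖f - y m‖ ^ P + ‖f - y n‖ ^ P) < ε * (2 * (d ^ P + 1)) := by
      gcongr; linarith
    have h6 : ε * (2 * (d ^ P + 1)) = η ^ P / 2 := by
      rw [hε]; field_simp; norm_num
    have h7 : C * ((‖f - y m‖ ^ P + ‖f - y n‖ ^ P) / 2 -
        ‖f - (1 / 2 : ℝ) • (y m + y n)‖ ^ P) ≤ C * δ := by
      gcongr; linarith
    have h8 : ‖y n - y m‖ ^ P < η ^ P := by linarith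
    rw [dist_comm, dist_eq_norm]
    exact (Real.rpow_lt_rpow_iff (norm_nonneg _) hη.le hP0).1 h8
  obtain ⟨α, hα⟩ := cauchySeq_tendsto_of_complete hcau
  refine ⟨α, hKc.mem_of_tendsto hα (Filter.Eventually.of_forall hyK), fun γ hγ ↦ ?_⟩
  have : Filter.Tendsto (fun n ↦ ‖f - y n‖) Filter.atTop (nhds ‖f - α‖) :=
    (tendsto_const_nhds.sub hα).norm
  rw [tendsto_nhds_unique this hlim]
  exact hlow γ hγ

theorem isNearest_lpProj [FiniteDimensional ℝ V] (M : Submodule ℝ (Lp V 2 μ)) (hp1 : 1 < p)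
    (hp : p ≠ ∞) (f : Lp V p μ) : IsNearest M p f (lpProj M p f) := by
  have h := exists_isNearest M hp1 hp f
  rw [lpProj, dif_pos h]
  exact h.choose_spec

end Nearest

end LpProjection

/-! ### The duality map and its monotonicity -/

namespace LpProjection

section Pointwise

variable {V : Type*} [NormedAddCommGroup V] [InnerProductSpace ℝ V]

theorem rpow_sub_one_mul_self {P a : ℝ} (hP : P ≠ 0) (ha : 0 ≤ a) : a ^ (P - 1) * a = a ^ P := by
  rw [← Real.rpow_add_one' ha (by simpa using hP), sub_add_cancel]

/-- Young's inequality with a free small constant, obtained by comparing `b` with `η * a`. -/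
theorem rpow_sub_one_mul_le {P η a b : ℝ} (hP : 1 < P) (hη : 0 < η) (ha : 0 ≤ a) (hb : 0 ≤ b) :
    a ^ (P - 1) * b ≤ η * a ^ P + (η⁻¹) ^ (P - 1) * b ^ P := by
  have hP0 : P ≠ 0 := by linarith
  have h1 : 0 ≤ a ^ P := Real.rpow_nonneg ha P
  have h2 : 0 ≤ b ^ P := Real.rpow_nonneg hb P
  have h3 : 0 ≤ (η⁻¹) ^ (P - 1) := by positivity
  rcases le_total b (η * a) with h | h
  · calc a ^ (P - 1) * b ≤ a ^ (P - 1) * (η * a) := by gcongr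
      _ = η * a ^ P := by rw [← rpow_sub_one_mul_self hP0 ha]; ring
      _ ≤ _ := le_add_of_nonneg_right (by positivity)
  · have h4 : a ≤ η⁻¹ * b := by
      rw [inv_mul_eq_div, le_div_iff₀ hη]; linarith
    calc a ^ (P - 1) * b ≤ (η⁻¹ * b) ^ (P - 1) * b := by gcongr
      _ = (η⁻¹) ^ (P - 1) * b ^ P := by
          rw [Real.mul_rpow (by positivity) hb, ← rpow_sub_one_mul_self hP0 hb]; ring
      _ ≤ _ := le_add_of_nonneg_left (by positivity)

/-- The duality map `v ↦ |v| ^ (P - 2) v`, up to a constant the gradient of `|v| ^ P`. -/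
noncomputable def powDual (P : ℝ) (v : V) : V := ‖v‖ ^ (P - 2) • v

theorem norm_powDual {P : ℝ} (hP : 1 < P) (v : V) : ‖powDual P v‖ = ‖v‖ ^ (P - 1) := by
  rw [powDual, norm_smul, Real.norm_of_nonneg (Real.rpow_nonneg (norm_nonneg v) _)]
  rw [← Real.rpow_add_one' (norm_nonneg v) (by linarith)]
  congr 1; ring

theorem inner_powDual_self {P : ℝ} (hP : 1 < P) (v : V) : inner ℝ (powDual P v) v = ‖v‖ ^ P := by
  rw [powDual, real_inner_smul_left, real_inner_self_eq_norm_sq, sq, ← mul_assoc,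
    ← Real.rpow_add_one' (norm_nonneg v) (by linarith),
    ← Real.rpow_add_one' (norm_nonneg v) (by linarith)]
  congr 1; ring

theorem abs_inner_powDual_le {P : ℝ} (hP : 1 < P) (v w : V) :
    |inner ℝ (powDual P v) w| ≤ ‖v‖ ^ (P - 1) * ‖w‖ := by
  rw [← norm_powDual hP]; exact abs_real_inner_le_norm _ _

theorem continuous_powDual {P : ℝ} (hP : 1 < P) : Continuous (powDual P : V → V) := by
  rw [continuous_iff_continuousAt]
  intro v
  by_cases hv : v = 0
  · subst hv
    have h0 : powDual P (0 : V) = 0 := by simp [powDual]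
    rw [ContinuousAt, h0, tendsto_zero_iff_norm_tendsto_zero]
    simp only [norm_powDual hP]
    have h1 : Continuous fun w : V ↦ ‖w‖ ^ (P - 1) :=
      (Real.continuous_rpow_const (by linarith)).comp continuous_norm
    simpa [Real.zero_rpow (sub_pos.2 hP).ne'] using h1.tendsto 0
  · exact ((continuous_norm.continuousAt).rpow_const (Or.inl (norm_ne_zero_iff.2 hv))).smul
      continuousAt_id

/-- The subgradient inequality of the convex function `‖·‖ ^ P` at `b`; Cauchy–Schwarz turns it into
Young's inequality for the norms. -/
theorem inner_powDual_sub_le {P : ℝ} (hP : 1 < P) (a b : V) :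
    P * inner ℝ (powDual P b) (a - b) ≤ ‖a‖ ^ P - ‖b‖ ^ P := by
  have hpq : P.HolderConjugate (P / (P - 1)) := Real.HolderConjugate.conjExponent hP
  have hP1 : 0 < P - 1 := by linarith
  have h1 := Real.young_inequality_of_nonneg (norm_nonneg a)
    (Real.rpow_nonneg (norm_nonneg b) (P - 1)) hpq
  rw [← Real.rpow_mul (norm_nonneg b), mul_div_cancel₀ P hP1.ne'] at h1
  have h2 := (le_abs_self _).trans (abs_inner_powDual_le hP b a)
  rw [inner_sub_right, inner_powDual_self hP]
  have h3 : P * (‖a‖ ^ P / P + ‖b‖ ^ P / (P / (P - 1))) = ‖a‖ ^ P + (P - 1) * ‖b‖ ^ P := by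
    field_simp
  have h4 : P * (‖a‖ * ‖b‖ ^ (P - 1)) ≤ ‖a‖ ^ P + (P - 1) * ‖b‖ ^ P := by
    rw [← h3]; gcongr
  nlinarith

/-- Cauchy–Schwarz on the two cross terms reduces the monotonicity of the duality map to that of `t
↦ t ^ (P - 1)`. -/
theorem le_inner_powDual_sub {P : ℝ} (hP : 1 < P) (h k : V) :
    (‖h‖ ^ (P - 1) - ‖k‖ ^ (P - 1)) * (‖h‖ - ‖k‖) ≤
      inner ℝ (powDual P h - powDual P k) (h - k) := by
  have h1 := (le_abs_self _).trans (abs_inner_powDual_le hP h k)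
  have h2 := (le_abs_self _).trans (abs_inner_powDual_le hP k h)
  have e1 := rpow_sub_one_mul_self (P := P) (by linarith) (norm_nonneg h)
  have e2 := rpow_sub_one_mul_self (P := P) (by linarith) (norm_nonneg k)
  simp only [inner_sub_left, inner_sub_right, inner_powDual_self hP]
  nlinarith

theorem inner_powDual_sub_nonneg {P : ℝ} (hP : 1 < P) (h k : V) :
    0 ≤ inner ℝ (powDual P h - powDual P k) (h - k) := by
  refine le_trans ?_ (le_inner_powDual_sub hP h k)
  have hP1 : 0 ≤ P - 1 := by linarith
  rcases le_total ‖h‖ ‖k‖ with hh | hh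
  · exact mul_nonneg_of_nonpos_of_nonpos
      (sub_nonpos.2 (Real.rpow_le_rpow (norm_nonneg _) hh hP1)) (sub_nonpos.2 hh)
  · exact mul_nonneg (sub_nonneg.2 (Real.rpow_le_rpow (norm_nonneg _) hh hP1)) (sub_nonneg.2 hh)

theorem le_inner_powDual_sub_of_two_mul_le {P : ℝ} (hP : 1 < P) {h k : V}
    (hk : 2 * ‖k‖ ≤ ‖h‖) :
    (1 - (2⁻¹ : ℝ) ^ (P - 1)) / 2 * ‖h‖ ^ P ≤
      inner ℝ (powDual P h - powDual P k) (h - k) := by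
  refine le_trans ?_ (le_inner_powDual_sub hP h k)
  have hP1 : 0 < P - 1 := by linarith
  have h1 : ‖k‖ ^ (P - 1) ≤ (2⁻¹ : ℝ) ^ (P - 1) * ‖h‖ ^ (P - 1) := by
    rw [← Real.mul_rpow (by norm_num) (norm_nonneg h)]
    exact Real.rpow_le_rpow (norm_nonneg _) (by linarith) hP1.le
  have h2 : (2⁻¹ : ℝ) ^ (P - 1) ≤ 1 := Real.rpow_le_one (by norm_num) (by norm_num) hP1.le
  have h3 : 0 ≤ ‖h‖ ^ (P - 1) := Real.rpow_nonneg (norm_nonneg h) _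
  rw [← rpow_sub_one_mul_self (by linarith : P ≠ 0) (norm_nonneg h)]
  calc (1 - (2⁻¹ : ℝ) ^ (P - 1)) / 2 * (‖h‖ ^ (P - 1) * ‖h‖)
      = ((1 - (2⁻¹ : ℝ) ^ (P - 1)) * ‖h‖ ^ (P - 1)) * (‖h‖ / 2) := by ring
    _ ≤ (‖h‖ ^ (P - 1) - ‖k‖ ^ (P - 1)) * (‖h‖ - ‖k‖) := by
        have h4 : 0 ≤ (1 - (2⁻¹ : ℝ) ^ (P - 1)) * ‖h‖ ^ (P - 1) :=
          mul_nonneg (sub_nonneg.2 h2) h3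
        refine mul_le_mul (by linarith) (by linarith) (by positivity) (by linarith)

/-- The pointwise inequality behind the comparison of the residuals of `f` and of a truncation
of `f`. -/
theorem exists_pointwise_comparison {P : ℝ} (hP : 1 < P) :
    ∃ K L : ℝ, 0 ≤ L ∧ ∀ h k e : V, ∀ T : ℝ, 0 ≤ T →
      (e ≠ 0 → ‖k‖ ≤ 2 * ‖h‖ → ‖e‖ < ‖k‖ → ‖k‖ ^ P ≤ T) → ∀ Y : ℝ,
      (Y = 0 ∨ 2 * ‖k‖ < ‖h‖ ∧ Y = ‖h‖ ^ P) →
      Y ≤ K * inner ℝ (powDual P h - powDual P k) (e - (h - k)) + L * (‖e‖ ^ P + T) := by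
  have hP1 : 0 < P - 1 := by linarith
  set c : ℝ := (1 - (2⁻¹ : ℝ) ^ (P - 1)) / 2 with hc
  have hcpos : 0 < c := by
    have : (2⁻¹ : ℝ) ^ (P - 1) < 1 := Real.rpow_lt_one (by norm_num) (by norm_num) hP1
    rw [hc]; linarith
  -- The first summand of `B` serves where one of `‖h‖`, `‖k‖` exceeds twice the other, the second
  -- where they are comparable.
  set B : ℝ := 2 * ((c / 4)⁻¹) ^ (P - 1) + (2 ^ (P - 1) + 1) with hB
  have hB1 : 2 * ((c / 4)⁻¹) ^ (P - 1) ≤ B := by 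
    rw [hB]; linarith [show (0 : ℝ) ≤ 2 ^ (P - 1) by positivity]
  have hB2 : 2 ^ (P - 1) + 1 ≤ B := by
    rw [hB]; linarith [show (0 : ℝ) ≤ ((c / 4)⁻¹) ^ (P - 1) by positivity]
  have hB0 : 0 ≤ B := by positivity
  -- The sign of `K` is immaterial: the inner product it multiplies will have integral zero.
  refine ⟨-(2 / c), 2 / c * B, by positivity, fun h k e T hT hTk Y hY ↦ ?_⟩
  suffices H : c / 2 * Y ≤ -inner ℝ (powDual P h - powDual P k) (e - (h - k)) +
      B * (‖e‖ ^ P + T) by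
    have := mul_le_mul_of_nonneg_left H (by positivity : 0 ≤ 2 / c)
    have e1 : 2 / c * (c / 2 * Y) = Y := by field_simp
    rw [e1] at this
    linarith
  have hm := inner_powDual_sub_nonneg hP h k
  have hin : inner ℝ (powDual P h - powDual P k) e ≤
      (‖h‖ ^ (P - 1) + ‖k‖ ^ (P - 1)) * ‖e‖ := by
    have h1 := (le_abs_self _).trans (abs_inner_powDual_le hP h e)
    have h2 := (neg_le_abs _).trans (abs_inner_powDual_le hP k e)
    rw [inner_sub_left]; linarith
  rw [inner_sub_right]
  have heP : 0 ≤ ‖e‖ ^ P := Real.rpow_nonneg (norm_nonneg e) P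
  -- Half of the coercive term `c * ‖u‖ ^ P` pays for the pairing with `e`.
  have habs : ∀ u v : V, 2 * ‖v‖ ≤ ‖u‖ →
      (‖u‖ ^ (P - 1) + ‖v‖ ^ (P - 1)) * ‖e‖ ≤ c / 2 * ‖u‖ ^ P + B * ‖e‖ ^ P := by
    intro u v huv
    have h1 : ‖v‖ ^ (P - 1) ≤ ‖u‖ ^ (P - 1) :=
      Real.rpow_le_rpow (norm_nonneg _) (by linarith [norm_nonneg v]) hP1.le
    have h2 := rpow_sub_one_mul_le hP (by positivity : 0 < c / 4) (norm_nonneg u) (norm_nonneg e)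
    have h3 := mul_le_mul_of_nonneg_right hB1 heP
    nlinarith [norm_nonneg e]
  by_cases hA : 2 * ‖k‖ < ‖h‖
  · have h1 := le_inner_powDual_sub_of_two_mul_le hP hA.le
    rw [← hc] at h1
    have h2 := habs h k hA.le
    have h3 : Y ≤ ‖h‖ ^ P := by
      rcases hY with rfl | ⟨-, rfl⟩
      · positivity
      · exact le_rfl
    have h4 : c / 2 * Y ≤ c / 2 * ‖h‖ ^ P := by gcongr
    have h5 : 0 ≤ B * T := by positivity
    linarith
  · have hY0 : Y = 0 := hY.resolve_right fun h ↦ hA h.1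
    rw [hY0, mul_zero]
    by_cases hA' : 2 * ‖h‖ < ‖k‖
    · have h1 := le_inner_powDual_sub_of_two_mul_le hP hA'.le
      rw [← hc] at h1
      have h2 := habs k h hA'.le
      have h3 : inner ℝ (powDual P k - powDual P h) (k - h) =
          inner ℝ (powDual P h - powDual P k) (h - k) := by
        rw [← neg_sub (powDual P h), ← neg_sub h, inner_neg_neg]
      rw [h3] at h1
      have h5 : 0 ≤ B * T := by positivity
      have h6 : 0 ≤ c / 2 * ‖k‖ ^ P := by positivity
      linarith
    · push Not at hA hA'
      -- When the norms are comparable only monotonicity is available, so the pairing with `e` is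
      -- paid for by `‖e‖ ^ P`, or by `T` where `‖e‖ < ‖k‖`.
      by_cases he : e = 0
      · subst he
        have h5 : 0 ≤ B * T := by positivity
        have h6 := mul_nonneg hB0 heP
        simp only [inner_zero_right]
        linarith
      · have h1 : ‖h‖ ^ (P - 1) ≤ 2 ^ (P - 1) * ‖k‖ ^ (P - 1) := by
          rw [← Real.mul_rpow (by norm_num) (norm_nonneg k)]
          exact Real.rpow_le_rpow (norm_nonneg _) hA hP1.le
        have h2 : ‖k‖ ^ (P - 1) * ‖e‖ ≤ ‖e‖ ^ P + T := by
          rcases le_or_gt ‖k‖ ‖e‖ with hke | hke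
          · calc ‖k‖ ^ (P - 1) * ‖e‖ ≤ ‖e‖ ^ (P - 1) * ‖e‖ := by gcongr
              _ = ‖e‖ ^ P := rpow_sub_one_mul_self (by linarith) (norm_nonneg e)
              _ ≤ _ := by linarith
          · calc ‖k‖ ^ (P - 1) * ‖e‖ ≤ ‖k‖ ^ (P - 1) * ‖k‖ := by gcongr
              _ = ‖k‖ ^ P := rpow_sub_one_mul_self (by linarith) (norm_nonneg k)
              _ ≤ T := hTk he hA' hke
              _ ≤ _ := by linarith
        have h3 : (‖h‖ ^ (P - 1) + ‖k‖ ^ (P - 1)) * ‖e‖ ≤ B * (‖e‖ ^ P + T) := by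
          calc (‖h‖ ^ (P - 1) + ‖k‖ ^ (P - 1)) * ‖e‖
              ≤ (2 ^ (P - 1) * ‖k‖ ^ (P - 1) + ‖k‖ ^ (P - 1)) * ‖e‖ := by gcongr
            _ = (2 ^ (P - 1) + 1) * (‖k‖ ^ (P - 1) * ‖e‖) := by ring
            _ ≤ B * (‖e‖ ^ P + T) := by gcongr
        linarith

end Pointwise

end LpProjection

/-! ### Orthogonality of the residual and comparison with a truncation -/

namespace LpProjection

variable {X : Type*} [MeasurableSpace X] {μ : Measure X}
  {V : Type*} [NormedAddCommGroup V] [InnerProductSpace ℝ V] {p : ℝ≥0∞}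

theorem rpow_sub_one_mul_le_add {P a b : ℝ} (hP : 1 < P) (ha : 0 ≤ a) (hb : 0 ≤ b) :
    a ^ (P - 1) * b ≤ a ^ P + b ^ P := by
  simpa using rpow_sub_one_mul_le hP one_pos ha hb

theorem one_lt_toReal (hp1 : 1 < p) (hp : p ≠ ∞) : 1 < p.toReal := by
  rwa [← ENNReal.toReal_one, ENNReal.toReal_lt_toReal ENNReal.one_ne_top hp]

theorem integrable_inner_powDual (hp1 : 1 < p) (hp : p ≠ ∞) {u w : X → V}
    (hu : MemLp u p μ) (hw : MemLp w p μ) :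
    Integrable (fun x ↦ inner ℝ (powDual p.toReal (u x)) (w x)) μ := by
  have hP := one_lt_toReal hp1 hp
  have hp0 : p ≠ 0 := (zero_lt_one.trans hp1).ne'
  refine ((hu.integrable_norm_rpow hp0 hp).add (hw.integrable_norm_rpow hp0 hp)).mono'
    (((continuous_powDual hP).comp_aestronglyMeasurable hu.1).inner hw.1) ?_
  filter_upwards with x
  exact (abs_inner_powDual_le hP _ _).trans
    (rpow_sub_one_mul_le_add hP (norm_nonneg _) (norm_nonneg _))

variable [Fact (1 ≤ p)]

/-- The first variation of `‖h - t • γ‖ ^ p`. The subgradient inequality taken at `h - t • γ` gives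
the sign for each `t > 0` without differentiating the norm, and then `t → 0` by dominated
convergence. -/
theorem integral_inner_powDual_nonpos (hp1 : 1 < p) (hp : p ≠ ∞) {h γ : Lp V p μ}
    (hmin : ∀ t : ℝ, 0 < t → ‖h‖ ≤ ‖h - t • γ‖) :
    ∫ x, inner ℝ (powDual p.toReal (h x)) (γ x) ∂μ ≤ 0 := by
  have hP := one_lt_toReal hp1 hp
  have hp0 : p ≠ 0 := (zero_lt_one.trans hp1).ne'
  set P := p.toReal with hPdef
  have hh := Lp.memLp h
  have hγ := Lp.memLp γ
  have hneg : ∀ t : ℝ, 0 < t → ∫ x, inner ℝ (powDual P (h x - t • γ x)) (γ x) ∂μ ≤ 0 := by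
    intro t ht
    have i1 := integrable_norm_rpow hp h
    have i2 := integrable_norm_rpow hp (h - t • γ)
    have i3 : Integrable (fun x ↦ inner ℝ (powDual P (h x - t • γ x)) (γ x)) μ :=
      integrable_inner_powDual hp1 hp (hh.sub (hγ.const_smul t)) hγ
    have h1 : ∫ x, (P * t) * inner ℝ (powDual P (h x - t • γ x)) (γ x) ∂μ ≤
        ∫ x, ‖h x‖ ^ P - ‖(h - t • γ : Lp V p μ) x‖ ^ P ∂μ := by
      refine integral_mono_ae (i3.const_mul _) (i1.sub i2) ?_
      filter_upwards [Lp.coeFn_sub h (t • γ), Lp.coeFn_smul t γ] with x e1 e2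
      simp only [e1, e2, Pi.sub_apply, Pi.smul_apply]
      have := inner_powDual_sub_le hP (h x) (h x - t • γ x)
      rw [sub_sub_cancel, real_inner_smul_right] at this
      linarith
    rw [integral_sub i1 i2, ← norm_rpow_eq_integral hp, ← norm_rpow_eq_integral hp,
      integral_const_mul] at h1
    have h2 : ‖h‖ ^ P ≤ ‖h - t • γ‖ ^ P :=
      Real.rpow_le_rpow (norm_nonneg _) (hmin t ht) (by linarith)
    have h3 : 0 < P * t := mul_pos (by linarith) ht
    by_contra hcon
    push Not at hcon
    have := mul_pos h3 hcon
    linarith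
  have hlim : Filter.Tendsto
      (fun n : ℕ ↦ ∫ x, inner ℝ (powDual P (h x - (1 / (n + 1 : ℝ)) • γ x)) (γ x) ∂μ)
      Filter.atTop (nhds (∫ x, inner ℝ (powDual P (h x)) (γ x) ∂μ)) := by
    refine tendsto_integral_of_dominated_convergence
      (fun x ↦ ‖‖h x‖ + ‖γ x‖‖ ^ P + ‖γ x‖ ^ P) (fun n ↦ ?_) ?_ (fun n ↦ ?_) ?_
    · exact (integrable_inner_powDual hp1 hp (hh.sub (hγ.const_smul _)) hγ).1
    · exact ((hh.norm.add hγ.norm).integrable_norm_rpow hp0 hp).add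
        (hγ.integrable_norm_rpow hp0 hp)
    · filter_upwards with x
      have ht0 : (0 : ℝ) ≤ 1 / (n + 1 : ℝ) := by positivity
      have ht1 : 1 / (n + 1 : ℝ) ≤ 1 := by
        rw [div_le_one (by positivity)]; linarith [n.cast_nonneg (α := ℝ)]
      have h1 : ‖h x - (1 / (n + 1 : ℝ)) • γ x‖ ≤ ‖‖h x‖ + ‖γ x‖‖ := by
        rw [Real.norm_of_nonneg (by positivity)]
        refine (norm_sub_le _ _).trans ?_
        rw [norm_smul, Real.norm_of_nonneg ht0]
        nlinarith [norm_nonneg (γ x)]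
      refine (abs_inner_powDual_le hP _ _).trans
        (le_trans ?_ (rpow_sub_one_mul_le_add hP (norm_nonneg _) (norm_nonneg _)))
      exact mul_le_mul_of_nonneg_right
        (Real.rpow_le_rpow (norm_nonneg _) h1 (by linarith)) (norm_nonneg _)
    · filter_upwards with x
      have h1 : Filter.Tendsto (fun n : ℕ ↦ h x - (1 / (n + 1 : ℝ)) • γ x) Filter.atTop
          (nhds (h x)) := by
        simpa using tendsto_const_nhds.sub
          ((tendsto_one_div_add_atTop_nhds_zero_nat (𝕜 := ℝ)).smul_const (γ x))
      exact (((continuous_powDual hP).tendsto _).comp h1).inner tendsto_const_nhds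
  exact le_of_tendsto hlim (Filter.Eventually.of_forall fun n ↦ hneg _ (by positivity))

/-- The residual of a nearest point, under the duality map, is orthogonal to `L^p₊`. -/
theorem IsNearest.integral_inner_eq_zero {M : Submodule ℝ (Lp V 2 μ)} (hp1 : 1 < p)
    (hp : p ≠ ∞) {f α γ : Lp V p μ} (hα : IsNearest M p f α) (hγ : γ ∈ lpPlus M p) :
    ∫ x, inner ℝ (powDual p.toReal ((f - α : Lp V p μ) x)) (γ x) ∂μ = 0 := by
  have key : ∀ γ ∈ lpPlus M p,
      ∫ x, inner ℝ (powDual p.toReal ((f - α : Lp V p μ) x)) (γ x) ∂μ ≤ 0 := by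
    intro γ hγ
    refine integral_inner_powDual_nonpos hp1 hp fun t _ ↦ ?_
    rw [sub_sub]
    exact hα.2 _ ((lpPlus M p).add_mem hα.1 ((lpPlus M p).smul_mem t hγ))
  refine le_antisymm (key γ hγ) ?_
  have h1 := key (-γ) ((lpPlus M p).neg_mem hγ)
  have h2 : ∫ x, inner ℝ (powDual p.toReal ((f - α : Lp V p μ) x)) ((-γ : Lp V p μ) x) ∂μ =
      -∫ x, inner ℝ (powDual p.toReal ((f - α : Lp V p μ) x)) (γ x) ∂μ := by
    rw [← integral_neg]
    refine integral_congr_ae ?_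
    filter_upwards [Lp.coeFn_neg γ] with x hx
    rw [hx, Pi.neg_apply, inner_neg_right]
  linarith

/-- The residual `f - ℜ_p f`. -/
noncomputable def residual (M : Submodule ℝ (Lp V 2 μ)) (p : ℝ≥0∞) [Fact (1 ≤ p)]
    (f : Lp V p μ) : Lp V p μ := f - lpProj M p f

omit [InnerProductSpace ℝ V] in
theorem setLIntegral_enorm_rpow (hp : p ≠ ∞) (u : Lp V p μ) (A : Set X) :
    ∫⁻ x in A, ‖u x‖ₑ ^ p.toReal ∂μ = ENNReal.ofReal (∫ x in A, ‖u x‖ ^ p.toReal ∂μ) := by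
  rw [ofReal_integral_eq_lintegral_ofReal (integrable_norm_rpow hp u).integrableOn
    (Filter.Eventually.of_forall fun x ↦ Real.rpow_nonneg (norm_nonneg _) _)]
  refine lintegral_congr fun x ↦ ?_
  rw [← ofReal_norm, ENNReal.ofReal_rpow_of_nonneg (norm_nonneg _) ENNReal.toReal_nonneg]

/-- Comparison of the residuals of `f` and of its truncation `g = f 1_{Sᶜ}`. -/
theorem exists_residual_comparison [FiniteDimensional ℝ V] (M : Submodule ℝ (Lp V 2 μ))
    (hp1 : 1 < p) (hp : p ≠ ∞) :
    ∃ K : ℝ≥0, ∀ (f g : Lp V p μ) (S : Set X), MeasurableSet S → g =ᵐ[μ] Sᶜ.indicator f →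
      ∫⁻ x in {x | 2 * ‖residual M p g x‖ < ‖residual M p f x‖},
          ‖residual M p f x‖ₑ ^ p.toReal ∂μ ≤
        K * (∫⁻ x in S, ‖f x‖ₑ ^ p.toReal ∂μ +
          ∫⁻ x in S ∩ {x | ‖residual M p g x‖ ≤ 2 * ‖residual M p f x‖ ∧
            ‖f x‖ < ‖residual M p g x‖}, ‖residual M p g x‖ₑ ^ p.toReal ∂μ) := by
  have hP := one_lt_toReal hp1 hp
  have hp0 : p ≠ 0 := (zero_lt_one.trans hp1).ne'
  set P := p.toReal with hPdef
  obtain ⟨K, L, hL, hKL⟩ := exists_pointwise_comparison (V := V) hP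
  refine ⟨L.toNNReal, fun f g S hS hg ↦ ?_⟩
  have hRf := isNearest_lpProj M hp1 hp f
  have hRg := isNearest_lpProj M hp1 hp g
  set h := residual M p f with hh
  set k := residual M p g with hk
  set A : Set X := {x | 2 * ‖k x‖ < ‖h x‖} with hA
  set B : Set X := S ∩ {x | ‖k x‖ ≤ 2 * ‖h x‖ ∧ ‖f x‖ < ‖k x‖} with hB
  have mh : Measurable fun x ↦ ‖h x‖ := (Lp.stronglyMeasurable h).norm.measurable
  have mk : Measurable fun x ↦ ‖k x‖ := (Lp.stronglyMeasurable k).norm.measurable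
  have mf : Measurable fun x ↦ ‖f x‖ := (Lp.stronglyMeasurable f).norm.measurable
  have mA : MeasurableSet A := measurableSet_lt (mk.const_mul 2) mh
  have mB : MeasurableSet B :=
    hS.inter ((measurableSet_le mk (mh.const_mul 2)).inter (measurableSet_lt mf mk))
  -- The one test function, orthogonal to both dual residuals; pointwise it equals `S.indicator f -
  -- (h - k)`.
  set γ : Lp V p μ := lpProj M p f - lpProj M p g with hγ
  have hγm : γ ∈ lpPlus M p := (lpPlus M p).sub_mem hRf.1 hRg.1
  have of : ∫ x, inner ℝ (powDual P (h x)) (γ x) ∂μ = 0 :=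
    hRf.integral_inner_eq_zero hp1 hp hγm
  have og : ∫ x, inner ℝ (powDual P (k x)) (γ x) ∂μ = 0 :=
    hRg.integral_inner_eq_zero hp1 hp hγm
  have jf : Integrable (fun x ↦ inner ℝ (powDual P (h x)) (γ x)) μ :=
    integrable_inner_powDual hp1 hp (Lp.memLp h) (Lp.memLp γ)
  have jg : Integrable (fun x ↦ inner ℝ (powDual P (k x)) (γ x)) μ :=
    integrable_inner_powDual hp1 hp (Lp.memLp k) (Lp.memLp γ)
  have iD : Integrable (fun x ↦ K * (inner ℝ (powDual P (h x)) (γ x) -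
      inner ℝ (powDual P (k x)) (γ x))) μ := (jf.sub jg).const_mul K
  have iE : Integrable (S.indicator fun x ↦ ‖f x‖ ^ P) μ :=
    (integrable_norm_rpow hp f).indicator hS
  have iT : Integrable (B.indicator fun x ↦ ‖k x‖ ^ P) μ :=
    (integrable_norm_rpow hp k).indicator mB
  have iS : Integrable (fun x ↦ L * (S.indicator (fun x ↦ ‖f x‖ ^ P) x +
      B.indicator (fun x ↦ ‖k x‖ ^ P) x)) μ := (iE.add iT).const_mul L
  have main : ∫ x, A.indicator (fun x ↦ ‖h x‖ ^ P) x ∂μ ≤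
      ∫ x, K * (inner ℝ (powDual P (h x)) (γ x) - inner ℝ (powDual P (k x)) (γ x)) +
        L * (S.indicator (fun x ↦ ‖f x‖ ^ P) x + B.indicator (fun x ↦ ‖k x‖ ^ P) x) ∂μ := by
    refine integral_mono_ae ((integrable_norm_rpow hp h).indicator mA) (iD.add iS) ?_
    filter_upwards [hg, Lp.coeFn_sub f (lpProj M p f), Lp.coeFn_sub g (lpProj M p g),
      Lp.coeFn_sub (lpProj M p f) (lpProj M p g)] with x e1 e2 e3 e4
    have e5 : γ x = S.indicator f x - (h x - k x) := by
      have e6 : S.indicator f x = f x - g x := by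
        rw [e1]; by_cases hx : x ∈ S <;> simp [hx]
      have e2' : h x = f x - lpProj M p f x := e2
      have e3' : k x = g x - lpProj M p g x := e3
      have e4' : γ x = lpProj M p f x - lpProj M p g x := e4
      rw [e6, e2', e3', e4']; abel
    have hsE : S.indicator (fun x ↦ ‖f x‖ ^ P) x = ‖S.indicator f x‖ ^ P := by
      by_cases hx : x ∈ S <;> simp [hx, Real.zero_rpow (by linarith : P ≠ 0)]
    simp only [← inner_sub_left, e5, hsE]
    -- `T` is `‖k‖ ^ P` on `B` and zero elsewhere, and `Y` is `‖h‖ ^ P` on `A` and zero elsewhere.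
    refine hKL (h x) (k x) (S.indicator f x) (B.indicator (fun x ↦ ‖k x‖ ^ P) x)
      (Set.indicator_nonneg (fun _ _ ↦ Real.rpow_nonneg (norm_nonneg _) _) _) ?_ _ ?_
    · intro hne h1 h2
      have hxS : x ∈ S := by by_contra hx; simp [hx] at hne
      have hxB : x ∈ B := ⟨hxS, h1, by simpa [hxS] using h2⟩
      simp [hxB]
    · by_cases hx : x ∈ A
      · exact Or.inr ⟨hx, by simp [hx]⟩
      · exact Or.inl (by simp [hx])
  rw [integral_add iD iS, integral_const_mul, integral_sub jf jg, of, og, integral_const_mul,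
    integral_add iE iT, integral_indicator mA, integral_indicator hS, integral_indicator mB,
    sub_zero, mul_zero, zero_add] at main
  have hn : ∀ (u : Lp V p μ) (C : Set X), 0 ≤ ∫ x in C, ‖u x‖ ^ P ∂μ := fun u C ↦
    integral_nonneg fun x ↦ Real.rpow_nonneg (norm_nonneg _) _
  rw [setLIntegral_enorm_rpow hp, setLIntegral_enorm_rpow hp, setLIntegral_enorm_rpow hp,
    ← ENNReal.ofReal_add (hn _ _) (hn _ _)]
  change _ ≤ ENNReal.ofReal L * _
  rw [← ENNReal.ofReal_mul hL]
  exact ENNReal.ofReal_le_ofReal main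

end LpProjection

/-! ### Truncated moments and distribution functions -/

namespace LpProjection

theorem lintegral_Ioc_rpow {e b : ℝ} (he : 0 < e) (hb : 0 ≤ b) :
    ∫⁻ t in Set.Ioc 0 b, ENNReal.ofReal (t ^ (e - 1)) = ENNReal.ofReal (b ^ e / e) := by
  have hi : IntervalIntegrable (fun t : ℝ ↦ t ^ (e - 1)) volume 0 b :=
    intervalIntegral.intervalIntegrable_rpow' (by linarith)
  rw [← ofReal_integral_eq_lintegral_ofReal
    ((intervalIntegrable_iff_integrableOn_Ioc_of_le hb).1 hi),
    ← intervalIntegral.integral_of_le hb, integral_rpow (Or.inl (by linarith)), sub_add_cancel,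
    Real.zero_rpow he.ne', sub_zero]
  filter_upwards [ae_restrict_mem measurableSet_Ioc] with t ht
  exact Real.rpow_nonneg ht.1.le _

theorem lintegral_Ioi_rpow {e b : ℝ} (he : 0 < e) (hb : 0 < b) :
    ∫⁻ t in Set.Ioi b, ENNReal.ofReal (t ^ (-e - 1)) = ENNReal.ofReal (b ^ (-e) / e) := by
  rw [← ofReal_integral_eq_lintegral_ofReal (integrableOn_Ioi_rpow_of_lt (by linarith) hb),
    integral_Ioi_rpow_of_lt (by linarith) hb, sub_add_cancel, neg_div_neg_eq]
  filter_upwards [ae_restrict_mem measurableSet_Ioi] with t ht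
  exact Real.rpow_nonneg (hb.le.trans (le_of_lt ht)) _

variable {X : Type*} [MeasurableSpace X] {μ : Measure X}

/-- A weak type bound at the exponent `s` bounds the `q`-th moment over high levels, `q < s`. -/
theorem setLIntegral_rpow_le_of_weak_of_lt {u : X → ℝ} (hu : Measurable u) (hu0 : ∀ x, 0 ≤ u x)
    {q s l : ℝ} (hq : 0 < q) (hqs : q < s) (hl : 0 < l) {W : ℝ≥0∞}
    (hW : ∀ t : ℝ, 0 < t → μ {x | t < u x} ≤ ENNReal.ofReal (t ^ (-s)) * W) :
    ∫⁻ x in {x | l < u x}, ENNReal.ofReal (u x ^ q) ∂μ ≤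
      ENNReal.ofReal (q * (1 / q + 1 / (s - q))) * (ENNReal.ofReal (l ^ (q - s)) * W) := by
  have hA : MeasurableSet {x | l < u x} := measurableSet_lt measurable_const hu
  set v : X → ℝ := {x | l < u x}.indicator u with hv
  have hv0 : ∀ x, 0 ≤ v x := fun x ↦ Set.indicator_nonneg (fun x _ ↦ hu0 x) x
  have hvm : Measurable v := hu.indicator hA
  have e1 : ∫⁻ x in {x | l < u x}, ENNReal.ofReal (u x ^ q) ∂μ =
      ∫⁻ x, ENNReal.ofReal (v x ^ q) ∂μ := by
    rw [← lintegral_indicator hA]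
    refine lintegral_congr fun x ↦ ?_
    by_cases hx : x ∈ {x | l < u x}
    · rw [hv, Set.indicator_of_mem hx, Set.indicator_of_mem hx]
    · rw [hv, Set.indicator_of_notMem hx, Set.indicator_of_notMem hx, Real.zero_rpow hq.ne',
        ENNReal.ofReal_zero]
  have hsub : ∀ t : ℝ, 0 < t → ∀ x, t < v x → l < u x ∧ t < u x := by
    intro t ht x hx
    by_cases hxA : x ∈ {x | l < u x}
    · rw [hv, Set.indicator_of_mem hxA] at hx; exact ⟨hxA, hx⟩
    · rw [hv, Set.indicator_of_notMem hxA] at hx; exact absurd hx ht.le.not_gt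
  rw [e1, lintegral_rpow_eq_lintegral_meas_lt_mul μ (Filter.Eventually.of_forall hv0)
    hvm.aemeasurable hq, ← Set.Ioc_union_Ioi_eq_Ioi hl.le,
    lintegral_union measurableSet_Ioi (Set.Ioc_disjoint_Ioi le_rfl)]
  -- Below `l` the level sets of `v` stay inside `{l < u}`, so the weak bound is used at the single
  -- level `l`; above `l` it is used at each `t`.
  have h1 : ∫⁻ t in Set.Ioc 0 l, μ {x | t < v x} * ENNReal.ofReal (t ^ (q - 1)) ≤
      ENNReal.ofReal (1 / q) * (ENNReal.ofReal (l ^ (q - s)) * W) := by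
    calc ∫⁻ t in Set.Ioc 0 l, μ {x | t < v x} * ENNReal.ofReal (t ^ (q - 1))
        ≤ ∫⁻ t in Set.Ioc 0 l, (ENNReal.ofReal (l ^ (-s)) * W) * ENNReal.ofReal (t ^ (q - 1)) := by
          refine setLIntegral_mono' measurableSet_Ioc fun t ht ↦ ?_
          gcongr
          exact (measure_mono fun x hx ↦ (hsub t ht.1 x hx).1).trans (hW l hl)
      _ = (ENNReal.ofReal (l ^ (-s)) * W) * ENNReal.ofReal (l ^ q / q) := by
          rw [lintegral_const_mul _ (by fun_prop), lintegral_Ioc_rpow hq hl.le]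
      _ = _ := by
          rw [show l ^ q / q = (1 / q) * l ^ q by ring, ENNReal.ofReal_mul (by positivity),
            show l ^ (q - s) = l ^ (-s) * l ^ q by rw [← Real.rpow_add hl]; congr 1; ring,
            ENNReal.ofReal_mul (by positivity)]
          ring
  have h2 : ∫⁻ t in Set.Ioi l, μ {x | t < v x} * ENNReal.ofReal (t ^ (q - 1)) ≤
      ENNReal.ofReal (1 / (s - q)) * (ENNReal.ofReal (l ^ (q - s)) * W) := by
    calc ∫⁻ t in Set.Ioi l, μ {x | t < v x} * ENNReal.ofReal (t ^ (q - 1))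
        ≤ ∫⁻ t in Set.Ioi l, W * ENNReal.ofReal (t ^ (-(s - q) - 1)) := by
          refine setLIntegral_mono' measurableSet_Ioi fun t ht ↦ ?_
          have ht0 : 0 < t := hl.trans ht
          calc μ {x | t < v x} * ENNReal.ofReal (t ^ (q - 1))
              ≤ (ENNReal.ofReal (t ^ (-s)) * W) * ENNReal.ofReal (t ^ (q - 1)) := by
                gcongr
                exact (measure_mono fun x hx ↦ (hsub t ht0 x hx).2).trans (hW t ht0)
            _ = W * ENNReal.ofReal (t ^ (-(s - q) - 1)) := by
                rw [show t ^ (-(s - q) - 1) = t ^ (-s) * t ^ (q - 1) by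
                  rw [← Real.rpow_add ht0]; congr 1; ring, ENNReal.ofReal_mul (by positivity)]
                ring
      _ = W * ENNReal.ofReal (l ^ (-(s - q)) / (s - q)) := by
          rw [lintegral_const_mul _ (by fun_prop), lintegral_Ioi_rpow (by linarith) hl]
      _ = _ := by
          have : 0 < s - q := by linarith
          rw [neg_sub, div_eq_mul_one_div, mul_comm (l ^ (q - s)),
            ENNReal.ofReal_mul (by positivity)]
          ring
  have h3 : 0 < s - q := by linarith
  rw [ENNReal.ofReal_mul hq.le, ENNReal.ofReal_add (by positivity) (by positivity), mul_assoc]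
  gcongr
  rw [add_mul]
  exact add_le_add h1 h2

/-- A weak type bound at the exponent `s` bounds the `q`-th moment over low levels, `s < q`. -/
theorem setLIntegral_rpow_le_of_weak_of_gt {u : X → ℝ} (hu : Measurable u) (hu0 : ∀ x, 0 ≤ u x)
    {q s l : ℝ} (hq : 0 < q) (hqs : s < q) (hl : 0 < l) {W : ℝ≥0∞}
    (hW : ∀ t : ℝ, 0 < t → μ {x | t < u x} ≤ ENNReal.ofReal (t ^ (-s)) * W) :
    ∫⁻ x in {x | u x ≤ l}, ENNReal.ofReal (u x ^ q) ∂μ ≤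
      ENNReal.ofReal (q / (q - s)) * (ENNReal.ofReal (l ^ (q - s)) * W) := by
  have hA : MeasurableSet {x | u x ≤ l} := measurableSet_le hu measurable_const
  set v : X → ℝ := {x | u x ≤ l}.indicator u with hv
  have hv0 : ∀ x, 0 ≤ v x := fun x ↦ Set.indicator_nonneg (fun x _ ↦ hu0 x) x
  have hvm : Measurable v := hu.indicator hA
  have e1 : ∫⁻ x in {x | u x ≤ l}, ENNReal.ofReal (u x ^ q) ∂μ =
      ∫⁻ x, ENNReal.ofReal (v x ^ q) ∂μ := by
    rw [← lintegral_indicator hA]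
    refine lintegral_congr fun x ↦ ?_
    by_cases hx : x ∈ {x | u x ≤ l}
    · rw [hv, Set.indicator_of_mem hx, Set.indicator_of_mem hx]
    · rw [hv, Set.indicator_of_notMem hx, Set.indicator_of_notMem hx, Real.zero_rpow hq.ne',
        ENNReal.ofReal_zero]
  have hsub : ∀ t : ℝ, 0 < t → ∀ x, t < v x → u x ≤ l ∧ t < u x := by
    intro t ht x hx
    by_cases hxA : x ∈ {x | u x ≤ l}
    · rw [hv, Set.indicator_of_mem hxA] at hx; exact ⟨hxA, hx⟩
    · rw [hv, Set.indicator_of_notMem hxA] at hx; exact absurd hx ht.le.not_gt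
  rw [e1, lintegral_rpow_eq_lintegral_meas_lt_mul μ (Filter.Eventually.of_forall hv0)
    hvm.aemeasurable hq, ← Set.Ioc_union_Ioi_eq_Ioi hl.le,
    lintegral_union measurableSet_Ioi (Set.Ioc_disjoint_Ioi le_rfl)]
  have h1 : ∫⁻ t in Set.Ioc 0 l, μ {x | t < v x} * ENNReal.ofReal (t ^ (q - 1)) ≤
      ENNReal.ofReal (1 / (q - s)) * (ENNReal.ofReal (l ^ (q - s)) * W) := by
    calc ∫⁻ t in Set.Ioc 0 l, μ {x | t < v x} * ENNReal.ofReal (t ^ (q - 1))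
        ≤ ∫⁻ t in Set.Ioc 0 l, W * ENNReal.ofReal (t ^ ((q - s) - 1)) := by
          refine setLIntegral_mono' measurableSet_Ioc fun t ht ↦ ?_
          have ht0 : 0 < t := ht.1
          calc μ {x | t < v x} * ENNReal.ofReal (t ^ (q - 1))
              ≤ (ENNReal.ofReal (t ^ (-s)) * W) * ENNReal.ofReal (t ^ (q - 1)) := by
                gcongr
                exact (measure_mono fun x hx ↦ (hsub t ht0 x hx).2).trans (hW t ht0)
            _ = W * ENNReal.ofReal (t ^ ((q - s) - 1)) := by
                rw [show t ^ ((q - s) - 1) = t ^ (-s) * t ^ (q - 1) by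
                  rw [← Real.rpow_add ht0]; congr 1; ring, ENNReal.ofReal_mul (by positivity)]
                ring
      _ = W * ENNReal.ofReal (l ^ (q - s) / (q - s)) := by
          rw [lintegral_const_mul _ (by fun_prop), lintegral_Ioc_rpow (by linarith) hl.le]
      _ = _ := by
          have : 0 < q - s := by linarith
          rw [div_eq_mul_one_div, mul_comm (l ^ (q - s)), ENNReal.ofReal_mul (by positivity)]
          ring
  have h2 : ∫⁻ t in Set.Ioi l, μ {x | t < v x} * ENNReal.ofReal (t ^ (q - 1)) = 0 := by
    rw [setLIntegral_congr_fun (g := fun _ ↦ 0) measurableSet_Ioi, lintegral_zero]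
    intro t ht
    have : {x | t < v x} = ∅ := by
      ext x
      simp only [Set.mem_ofPred_eq, Set.mem_empty_iff_false, iff_false]
      intro hx
      have h3 := hsub t (hl.trans ht) x hx
      exact absurd (h3.2.trans_le h3.1) (lt_asymm ht)
    simp [this]
  have h3 : 0 < q - s := by linarith
  rw [h2, add_zero, div_eq_mul_one_div, ENNReal.ofReal_mul hq.le, mul_assoc]
  gcongr

/-- By Tonelli: for fixed `x` the levels run over `0 < t < u x / δ`, where `t ^ (r - a - 1)` is
integrable because `a < r`. -/
theorem lintegral_rpow_mul_setLIntegral_gt [SFinite μ] {u : X → ℝ} (hu : Measurable u)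
    (hu0 : ∀ x, 0 ≤ u x) {a r δ : ℝ} (har : a < r) (hr : 0 < r) (hδ : 0 < δ) :
    ∫⁻ t in Set.Ioi (0 : ℝ), ENNReal.ofReal (t ^ (r - a - 1)) *
        ∫⁻ x in {x | δ * t < u x}, ENNReal.ofReal (u x ^ a) ∂μ ≤
      ENNReal.ofReal (δ⁻¹ ^ (r - a) / (r - a)) * ∫⁻ x, ENNReal.ofReal (u x ^ r) ∂μ := by
  have hra : 0 < r - a := by linarith
  have hpm : Measurable fun z : ℝ × X ↦ {z : ℝ × X | δ * z.1 < u z.2}.indicator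
      (fun z ↦ ENNReal.ofReal (z.1 ^ (r - a - 1)) * ENNReal.ofReal (u z.2 ^ a)) z := by
    refine Measurable.indicator (by fun_prop) ?_
    exact measurableSet_lt (by fun_prop) (by fun_prop)
  calc ∫⁻ t in Set.Ioi (0 : ℝ), ENNReal.ofReal (t ^ (r - a - 1)) *
        ∫⁻ x in {x | δ * t < u x}, ENNReal.ofReal (u x ^ a) ∂μ
      = ∫⁻ t in Set.Ioi (0 : ℝ), ∫⁻ x, {z : ℝ × X | δ * z.1 < u z.2}.indicator
          (fun z ↦ ENNReal.ofReal (z.1 ^ (r - a - 1)) * ENNReal.ofReal (u z.2 ^ a)) (t, x) ∂μ := by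
        refine lintegral_congr fun t ↦ ?_
        rw [← lintegral_const_mul _ (by fun_prop),
          ← lintegral_indicator (measurableSet_lt measurable_const hu)]
        rfl
    _ = ∫⁻ x, (∫⁻ t in Set.Ioi (0 : ℝ), {z : ℝ × X | δ * z.1 < u z.2}.indicator
          (fun z ↦ ENNReal.ofReal (z.1 ^ (r - a - 1)) * ENNReal.ofReal (u z.2 ^ a)) (t, x)) ∂μ :=
        lintegral_lintegral_swap hpm.aemeasurable
    _ ≤ ∫⁻ x, ENNReal.ofReal (δ⁻¹ ^ (r - a) / (r - a)) * ENNReal.ofReal (u x ^ r) ∂μ := by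
        refine lintegral_mono fun x ↦ ?_
        have hb : 0 ≤ δ⁻¹ * u x := mul_nonneg (by positivity) (hu0 x)
        calc ∫⁻ t in Set.Ioi (0 : ℝ), {z : ℝ × X | δ * z.1 < u z.2}.indicator
              (fun z ↦ ENNReal.ofReal (z.1 ^ (r - a - 1)) * ENNReal.ofReal (u z.2 ^ a)) (t, x)
            ≤ ∫⁻ t in Set.Ioi (0 : ℝ), (Set.Ioc 0 (δ⁻¹ * u x)).indicator
              (fun t ↦ ENNReal.ofReal (t ^ (r - a - 1)) * ENNReal.ofReal (u x ^ a)) t := by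
              refine setLIntegral_mono' measurableSet_Ioi fun t ht ↦ ?_
              by_cases h : δ * t < u x
              · have ht' : t ∈ Set.Ioc 0 (δ⁻¹ * u x) := ⟨ht, by
                  rw [inv_mul_eq_div, le_div_iff₀ hδ]; linarith⟩
                rw [Set.indicator_of_mem ht', Set.indicator_of_mem
                  (show (t, x) ∈ {z : ℝ × X | δ * z.1 < u z.2} from h)]
              · rw [Set.indicator_of_notMem
                  (show (t, x) ∉ {z : ℝ × X | δ * z.1 < u z.2} from h)]
                exact zero_le
          _ ≤ ∫⁻ t, (Set.Ioc 0 (δ⁻¹ * u x)).indicator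
              (fun t ↦ ENNReal.ofReal (t ^ (r - a - 1)) * ENNReal.ofReal (u x ^ a)) t :=
              setLIntegral_le_lintegral _ _
          _ = ENNReal.ofReal ((δ⁻¹ * u x) ^ (r - a) / (r - a)) * ENNReal.ofReal (u x ^ a) := by
              rw [lintegral_indicator measurableSet_Ioc, lintegral_mul_const _ (by fun_prop),
                lintegral_Ioc_rpow hra hb]
          _ = ENNReal.ofReal (δ⁻¹ ^ (r - a) / (r - a)) * ENNReal.ofReal (u x ^ r) := by
              rw [← ENNReal.ofReal_mul (by positivity), ← ENNReal.ofReal_mul (by positivity)]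
              congr 1
              rw [Real.mul_rpow (by positivity) (hu0 x)]
              rw [show u x ^ r = u x ^ (r - a) * u x ^ a by
                rw [← Real.rpow_add' (hu0 x) (by simpa using hr.ne'), sub_add_cancel]]
              ring
    _ = _ := lintegral_const_mul _ (by fun_prop)

/-- By Tonelli again: now `t ≥ u x / δ`, and convergence at infinity comes from `r < b`. Points with
`u x = 0` are treated apart, as their range of levels reaches down to zero. -/
theorem lintegral_rpow_mul_setLIntegral_le [SFinite μ] {u : X → ℝ} (hu : Measurable u)
    (hu0 : ∀ x, 0 ≤ u x) {b r δ : ℝ} (hrb : r < b) (hr : 0 < r) (hδ : 0 < δ) :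
    ∫⁻ t in Set.Ioi (0 : ℝ), ENNReal.ofReal (t ^ (r - b - 1)) *
        ∫⁻ x in {x | u x ≤ δ * t}, ENNReal.ofReal (u x ^ b) ∂μ ≤
      ENNReal.ofReal (δ⁻¹ ^ (r - b) / (b - r)) * ∫⁻ x, ENNReal.ofReal (u x ^ r) ∂μ := by
  have hbr : 0 < b - r := by linarith
  have hpm : Measurable fun z : ℝ × X ↦ {z : ℝ × X | u z.2 ≤ δ * z.1}.indicator
      (fun z ↦ ENNReal.ofReal (z.1 ^ (r - b - 1)) * ENNReal.ofReal (u z.2 ^ b)) z := by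
    refine Measurable.indicator (by fun_prop) ?_
    exact measurableSet_le (by fun_prop) (by fun_prop)
  calc ∫⁻ t in Set.Ioi (0 : ℝ), ENNReal.ofReal (t ^ (r - b - 1)) *
        ∫⁻ x in {x | u x ≤ δ * t}, ENNReal.ofReal (u x ^ b) ∂μ
      = ∫⁻ t in Set.Ioi (0 : ℝ), ∫⁻ x, {z : ℝ × X | u z.2 ≤ δ * z.1}.indicator
          (fun z ↦ ENNReal.ofReal (z.1 ^ (r - b - 1)) * ENNReal.ofReal (u z.2 ^ b)) (t, x) ∂μ := by
        refine lintegral_congr fun t ↦ ?_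
        rw [← lintegral_const_mul _ (by fun_prop),
          ← lintegral_indicator (measurableSet_le hu measurable_const)]
        rfl
    _ = ∫⁻ x, (∫⁻ t in Set.Ioi (0 : ℝ), {z : ℝ × X | u z.2 ≤ δ * z.1}.indicator
          (fun z ↦ ENNReal.ofReal (z.1 ^ (r - b - 1)) * ENNReal.ofReal (u z.2 ^ b)) (t, x)) ∂μ :=
        lintegral_lintegral_swap hpm.aemeasurable
    _ ≤ ∫⁻ x, ENNReal.ofReal (δ⁻¹ ^ (r - b) / (b - r)) * ENNReal.ofReal (u x ^ r) ∂μ := by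
        refine lintegral_mono fun x ↦ ?_
        rcases (hu0 x).eq_or_lt with h0 | hpos
        · have : ∀ t, {z : ℝ × X | u z.2 ≤ δ * z.1}.indicator
              (fun z ↦ ENNReal.ofReal (z.1 ^ (r - b - 1)) * ENNReal.ofReal (u z.2 ^ b))
              (t, x) = 0 := fun t ↦ by
            simp [Set.indicator_apply, ← h0, Real.zero_rpow (hr.trans hrb).ne']
          simp only [this, lintegral_zero]
          exact zero_le
        have hb : 0 < δ⁻¹ * u x := mul_pos (by positivity) hpos
        calc ∫⁻ t in Set.Ioi (0 : ℝ), {z : ℝ × X | u z.2 ≤ δ * z.1}.indicator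
              (fun z ↦ ENNReal.ofReal (z.1 ^ (r - b - 1)) * ENNReal.ofReal (u z.2 ^ b)) (t, x)
            ≤ ∫⁻ t in Set.Ioi (0 : ℝ), (Set.Ici (δ⁻¹ * u x)).indicator
              (fun t ↦ ENNReal.ofReal (t ^ (r - b - 1)) * ENNReal.ofReal (u x ^ b)) t := by
              refine setLIntegral_mono' measurableSet_Ioi fun t ht ↦ ?_
              by_cases h : u x ≤ δ * t
              · have ht' : t ∈ Set.Ici (δ⁻¹ * u x) := by
                  rw [Set.mem_Ici, inv_mul_eq_div, div_le_iff₀ hδ]; linarith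
                rw [Set.indicator_of_mem ht', Set.indicator_of_mem
                  (show (t, x) ∈ {z : ℝ × X | u z.2 ≤ δ * z.1} from h)]
              · rw [Set.indicator_of_notMem
                  (show (t, x) ∉ {z : ℝ × X | u z.2 ≤ δ * z.1} from h)]
                exact zero_le
          _ ≤ ∫⁻ t, (Set.Ici (δ⁻¹ * u x)).indicator
              (fun t ↦ ENNReal.ofReal (t ^ (r - b - 1)) * ENNReal.ofReal (u x ^ b)) t :=
              setLIntegral_le_lintegral _ _
          _ = ENNReal.ofReal ((δ⁻¹ * u x) ^ (r - b) / (b - r)) * ENNReal.ofReal (u x ^ b) := by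
              rw [lintegral_indicator measurableSet_Ici, lintegral_mul_const _ (by fun_prop),
                setLIntegral_congr Ioi_ae_eq_Ici.symm,
                show r - b = -(b - r) by ring, lintegral_Ioi_rpow hbr hb]
          _ = ENNReal.ofReal (δ⁻¹ ^ (r - b) / (b - r)) * ENNReal.ofReal (u x ^ r) := by
              rw [← ENNReal.ofReal_mul (by positivity), ← ENNReal.ofReal_mul (by positivity)]
              congr 1
              rw [Real.mul_rpow (by positivity) (hu0 x)]
              rw [show u x ^ r = u x ^ (r - b) * u x ^ b by
                rw [← Real.rpow_add hpos, sub_add_cancel]]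
              ring
    _ = _ := lintegral_const_mul _ (by fun_prop)

/-- A bound of the distribution function of `v` by truncated moments of `u`, of orders
`a < r < b`, gives a bound of the `r`-th moment. -/
theorem exists_lintegral_rpow_le_of_level_bound [SFinite μ] {a b r δ : ℝ} (har : a < r)
    (hrb : r < b) (hr : 0 < r) (hδ : 0 < δ) (C : ℝ≥0) :
    ∃ C' : ℝ≥0, ∀ u v : X → ℝ, Measurable u → (∀ x, 0 ≤ u x) → Measurable v → (∀ x, 0 ≤ v x) →
      (∀ t : ℝ, 0 < t → μ {x | t < v x} ≤ C *
        (ENNReal.ofReal (t ^ (-a)) * ∫⁻ x in {x | δ * t < u x}, ENNReal.ofReal (u x ^ a) ∂μ +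
        ENNReal.ofReal (t ^ (-b)) * ∫⁻ x in {x | u x ≤ δ * t}, ENNReal.ofReal (u x ^ b) ∂μ)) →
      ∫⁻ x, ENNReal.ofReal (v x ^ r) ∂μ ≤ C' * ∫⁻ x, ENNReal.ofReal (u x ^ r) ∂μ := by
  refine ⟨r.toNNReal * (C * ((δ⁻¹ ^ (r - a) / (r - a)).toNNReal +
    (δ⁻¹ ^ (r - b) / (b - r)).toNNReal)), fun u v hu hu0 hv hv0 hle ↦ ?_⟩
  have hpm : Measurable fun t : ℝ ↦ ∫⁻ x in {x | δ * t < u x}, ENNReal.ofReal (u x ^ a) ∂μ := by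
    have : Measurable fun z : ℝ × X ↦ {z : ℝ × X | δ * z.1 < u z.2}.indicator
        (fun z ↦ ENNReal.ofReal (u z.2 ^ a)) z :=
      Measurable.indicator (by fun_prop) (measurableSet_lt (by fun_prop) (by fun_prop))
    convert this.lintegral_prod_right' (ν := μ) using 2 with t
    rw [← lintegral_indicator (measurableSet_lt measurable_const hu)]
    rfl
  rw [lintegral_rpow_eq_lintegral_meas_lt_mul μ (Filter.Eventually.of_forall hv0)
    hv.aemeasurable hr]
  have h1 := lintegral_rpow_mul_setLIntegral_gt (μ := μ) hu hu0 har hr hδ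
  have h2 := lintegral_rpow_mul_setLIntegral_le (μ := μ) hu hu0 hrb hr hδ
  push_cast
  rw [mul_assoc, mul_assoc]
  change ENNReal.ofReal r * _ ≤ ENNReal.ofReal r * _
  gcongr
  calc ∫⁻ t in Set.Ioi (0 : ℝ), μ {x | t < v x} * ENNReal.ofReal (t ^ (r - 1))
      ≤ ∫⁻ t in Set.Ioi (0 : ℝ), C * (ENNReal.ofReal (t ^ (r - a - 1)) *
          (∫⁻ x in {x | δ * t < u x}, ENNReal.ofReal (u x ^ a) ∂μ) +
          ENNReal.ofReal (t ^ (r - b - 1)) *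
          ∫⁻ x in {x | u x ≤ δ * t}, ENNReal.ofReal (u x ^ b) ∂μ) := by
        refine setLIntegral_mono' measurableSet_Ioi fun t ht ↦ ?_
        have ht0 : 0 < t := ht
        have hpow : ∀ c : ℝ, ENNReal.ofReal (t ^ (r - c - 1)) =
            ENNReal.ofReal (t ^ (-c)) * ENNReal.ofReal (t ^ (r - 1)) := fun c ↦ by
          rw [← ENNReal.ofReal_mul (by positivity), ← Real.rpow_add ht0]; congr 2; ring
        refine (mul_le_mul_left (hle t ht) _).trans (le_of_eq ?_)
        rw [hpow, hpow]; ring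
    _ = C * ((∫⁻ t in Set.Ioi (0 : ℝ), ENNReal.ofReal (t ^ (r - a - 1)) *
          ∫⁻ x in {x | δ * t < u x}, ENNReal.ofReal (u x ^ a) ∂μ) +
          ∫⁻ t in Set.Ioi (0 : ℝ), ENNReal.ofReal (t ^ (r - b - 1)) *
          ∫⁻ x in {x | u x ≤ δ * t}, ENNReal.ofReal (u x ^ b) ∂μ) := by
        rw [lintegral_const_mul' _ _ ENNReal.coe_ne_top, lintegral_add_left]
        exact Measurable.mul (by fun_prop) hpm
    _ ≤ C * ((ENNReal.ofReal (δ⁻¹ ^ (r - a) / (r - a)) +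
          ENNReal.ofReal (δ⁻¹ ^ (r - b) / (b - r))) * ∫⁻ x, ENNReal.ofReal (u x ^ r) ∂μ) := by
        rw [add_mul]; gcongr

end LpProjection

/-! ### Level bounds for the residual -/

namespace LpProjection

theorem ofReal_mul_rpow {c l : ℝ} (hc : 0 ≤ c) (hl : 0 ≤ l) (e : ℝ) :
    ENNReal.ofReal ((c * l) ^ e) = ENNReal.ofReal (c ^ e) * ENNReal.ofReal (l ^ e) := by
  rw [Real.mul_rpow hc hl, ENNReal.ofReal_mul (by positivity)]

theorem ofReal_rpow_mul_ofReal_rpow {l : ℝ} (hl : 0 < l) {a b c : ℝ} (h : a + b = c) :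
    ENNReal.ofReal (l ^ a) * ENNReal.ofReal (l ^ b) = ENNReal.ofReal (l ^ c) := by
  rw [← ENNReal.ofReal_mul (by positivity), ← Real.rpow_add hl, h]

theorem enorm_rpow_eq_ofReal {V : Type*} [NormedAddCommGroup V] (v : V) {q : ℝ} (hq : 0 ≤ q) :
    ‖v‖ₑ ^ q = ENNReal.ofReal (‖v‖ ^ q) := by
  rw [← ofReal_norm, ENNReal.ofReal_rpow_of_nonneg (norm_nonneg _) hq]

variable {X : Type*} [MeasurableSpace X] {μ : Measure X}

theorem measure_lt_le_ofReal_rpow_mul {u : X → ℝ} (hu : Measurable u)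
    {q l : ℝ} (hq : 0 < q) (hl : 0 < l) (A : Set X) (hA : MeasurableSet A) :
    μ ({x | l < u x} ∩ A) ≤
      ENNReal.ofReal (l ^ (-q)) * ∫⁻ x in A, ENNReal.ofReal (u x ^ q) ∂μ := by
  have h1 := mul_meas_ge_le_lintegral (μ := μ.restrict A)
    (f := fun x ↦ ENNReal.ofReal (u x ^ q)) (by fun_prop) (ENNReal.ofReal (l ^ q))
  calc μ ({x | l < u x} ∩ A)
      = ENNReal.ofReal (l ^ (-q)) * (ENNReal.ofReal (l ^ q) * μ ({x | l < u x} ∩ A)) := by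
        rw [← mul_assoc, ofReal_rpow_mul_ofReal_rpow hl (neg_add_cancel q)]; simp
    _ ≤ ENNReal.ofReal (l ^ (-q)) *
        (ENNReal.ofReal (l ^ q) * μ.restrict A {x | ENNReal.ofReal (l ^ q) ≤
          ENNReal.ofReal (u x ^ q)}) := by
        rw [← Measure.restrict_apply' hA]
        refine mul_le_mul_right (mul_le_mul_right (measure_mono fun x hx ↦ ?_) _) _
        refine ENNReal.ofReal_le_ofReal ?_
        exact Real.rpow_le_rpow hl.le (le_of_lt hx) hq.le
    _ ≤ _ := by gcongr

variable {V : Type*} [NormedAddCommGroup V] {p : ℝ≥0∞}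

theorem measurable_norm_lp (f : Lp V p μ) : Measurable fun x ↦ ‖f x‖ :=
  (Lp.stronglyMeasurable f).norm.measurable

theorem exists_lp_eq_indicator (f : Lp V p μ) {S : Set X} (hS : MeasurableSet S) :
    ∃ g : Lp V p μ, g =ᵐ[μ] S.indicator f :=
  ⟨((Lp.memLp f).indicator hS).toLp _, MemLp.coeFn_toLp _⟩

theorem lintegral_indicator_rpow {f g : Lp V p μ} {S : Set X} (hS : MeasurableSet S)
    (hg : g =ᵐ[μ] S.indicator f) {q : ℝ} (hq : 0 < q) :
    ∫⁻ x, ENNReal.ofReal (‖g x‖ ^ q) ∂μ = ∫⁻ x in S, ENNReal.ofReal (‖f x‖ ^ q) ∂μ := by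
  rw [← lintegral_indicator hS]
  refine lintegral_congr_ae ?_
  filter_upwards [hg] with x hx
  rw [hx]
  by_cases h : x ∈ S <;> simp [h, Real.zero_rpow hq.ne']

theorem memLp_of_lintegral_lt_top {g : Lp V p μ} {s : ℝ≥0∞} (hs0 : s ≠ 0) (hs : s ≠ ∞)
    (h : ∫⁻ x, ENNReal.ofReal (‖g x‖ ^ s.toReal) ∂μ < ∞) : MemLp g s μ := by
  refine ⟨(Lp.memLp g).1, ?_⟩
  rw [eLpNorm_lt_top_iff_lintegral_rpow_enorm_lt_top hs0 hs]
  simpa only [enorm_rpow_eq_ofReal _ ENNReal.toReal_nonneg] using h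

variable [InnerProductSpace ℝ V] [Fact (1 ≤ p)]

theorem coeFn_residual (M : Submodule ℝ (Lp V 2 μ)) (f : Lp V p μ) :
    ∀ᵐ x ∂μ, residual M p f x = f x - lpProj M p f x := by
  filter_upwards [Lp.coeFn_sub f (lpProj M p f)] with x hx using hx

/-- A weak type bound for `ℜ_p` gives one for the residual. -/
theorem exists_residual_weak_type {M : Submodule ℝ (Lp V 2 μ)} {s : ℝ≥0∞} (hs0 : s ≠ 0)
    (hs : s ≠ ∞) (hw : WeakType (lpProj M p) s) :
    ∃ C : ℝ≥0, ∀ g : Lp V p μ, MemLp g s μ → ∀ t : ℝ, 0 < t →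
      μ {x | t < ‖residual M p g x‖} ≤ ENNReal.ofReal (t ^ (-s.toReal)) *
        (C * ∫⁻ x, ENNReal.ofReal (‖g x‖ ^ s.toReal) ∂μ) := by
  obtain ⟨C, hC⟩ := hw
  have hsp : 0 < s.toReal := ENNReal.toReal_pos hs0 hs
  refine ⟨((1 / 2 : ℝ) ^ (-s.toReal)).toNNReal * (1 + C), fun g hg t ht ↦ ?_⟩
  have h1 := hC g hg
  rw [if_neg hs] at h1
  have h2 := h1 (1 / 2 * t).toNNReal (by simpa using ht)
  have h3 := measure_lt_le_ofReal_rpow_mul (μ := μ) (measurable_norm_lp g) hsp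
    (show 0 < 1 / 2 * t by positivity) Set.univ MeasurableSet.univ
  rw [Set.inter_univ, Measure.restrict_univ] at h3
  simp only [enorm_rpow_eq_ofReal _ ENNReal.toReal_nonneg] at h2
  have h4 : ((1 / 2 * t).toNNReal : ℝ≥0∞) ^ (-s.toReal) =
      ENNReal.ofReal ((1 / 2 * t) ^ (-s.toReal)) :=
    ENNReal.ofReal_rpow_of_pos (by positivity)
  have h5 : {x | (1 / 2 * t).toNNReal < ‖lpProj M p g x‖₊} =
      {x | 1 / 2 * t < ‖lpProj M p g x‖} := by
    ext x
    simp only [Set.mem_ofPred_eq]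
    rw [Real.toNNReal_lt_iff_lt_coe (by positivity), coe_nnnorm]
  rw [h4, h5] at h2
  have h6 : μ {x | t < ‖residual M p g x‖} ≤
      μ ({x | 1 / 2 * t < ‖g x‖} ∪ {x | 1 / 2 * t < ‖lpProj M p g x‖}) := by
    refine measure_mono_ae ?_
    filter_upwards [coeFn_residual M g] with x hx hlt
    change t < ‖residual M p g x‖ at hlt
    change 1 / 2 * t < ‖g x‖ ∨ 1 / 2 * t < ‖lpProj M p g x‖
    by_contra hcon
    push Not at hcon
    rw [hx] at hlt
    have := norm_sub_le (g x) (lpProj M p g x)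
    linarith [hcon.1, hcon.2]
  refine (h6.trans (measure_union_le _ _)).trans ((add_le_add h3 h2).trans (le_of_eq ?_))
  rw [ofReal_mul_rpow (by norm_num) ht.le]
  push_cast
  change _ = ENNReal.ofReal (t ^ (-s.toReal)) *
    (ENNReal.ofReal ((1 / 2 : ℝ) ^ (-s.toReal)) * (1 + C) * _)
  ring

/-- The distribution function of the residual of `f`, in terms of the residual of a truncation
of `f`. -/
theorem exists_residual_level_comparison [FiniteDimensional ℝ V] (M : Submodule ℝ (Lp V 2 μ))
    (hp1 : 1 < p) (hp : p ≠ ∞) :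
    ∃ K : ℝ≥0, ∀ (f g : Lp V p μ) (S : Set X), MeasurableSet S → g =ᵐ[μ] Sᶜ.indicator f →
      ∀ l : ℝ, 0 < l → μ {x | l < ‖residual M p f x‖} ≤ μ {x | 1 / 2 * l < ‖residual M p g x‖} +
        ENNReal.ofReal (l ^ (-p.toReal)) *
        (K * (∫⁻ x in S, ENNReal.ofReal (‖f x‖ ^ p.toReal) ∂μ +
          ∫⁻ x in S ∩ {x | ‖residual M p g x‖ ≤ 2 * ‖residual M p f x‖ ∧
            ‖f x‖ < ‖residual M p g x‖}, ENNReal.ofReal (‖residual M p g x‖ ^ p.toReal) ∂μ)) := by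
  obtain ⟨K, hK⟩ := exists_residual_comparison M hp1 hp
  have hP := one_lt_toReal hp1 hp
  refine ⟨K, fun f g S hS hg l hl ↦ ?_⟩
  have h1 := hK f g S hS hg
  simp only [enorm_rpow_eq_ofReal _ ENNReal.toReal_nonneg] at h1
  have mA : MeasurableSet {x | 2 * ‖residual M p g x‖ < ‖residual M p f x‖} :=
    measurableSet_lt ((measurable_norm_lp _).const_mul 2) (measurable_norm_lp _)
  have h2 := measure_lt_le_ofReal_rpow_mul (μ := μ) (measurable_norm_lp (residual M p f))
    (by linarith : 0 < p.toReal) hl _ mA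
  -- Where the residual of `f` is at most twice that of `g`, a value above `l` forces the latter
  -- above `l / 2`; elsewhere Chebyshev applies.
  refine (measure_mono (t := {x | 1 / 2 * l < ‖residual M p g x‖} ∪
    ({x | l < ‖residual M p f x‖} ∩ {x | 2 * ‖residual M p g x‖ < ‖residual M p f x‖}))
    fun x hx ↦ ?_).trans ((measure_union_le _ _).trans ?_)
  · change l < ‖residual M p f x‖ at hx
    by_cases h : 2 * ‖residual M p g x‖ < ‖residual M p f x‖
    · exact Or.inr ⟨hx, h⟩
    · refine Or.inl ?_
      change 1 / 2 * l < ‖residual M p g x‖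
      linarith
  · gcongr
    exact h2.trans (by gcongr)

/-- The distribution function of the residual when `ℜ_p` has weak type at a finite exponent
`s > p`. -/
theorem exists_residual_level_bound_of_lt [FiniteDimensional ℝ V] {M : Submodule ℝ (Lp V 2 μ)}
    (hp1 : 1 < p) (hp : p ≠ ∞) {s : ℝ≥0∞} (hs : s ≠ ∞) (hps : p < s)
    (hw : WeakType (lpProj M p) s) :
    ∃ C : ℝ≥0, ∀ f : Lp V p μ, ∀ l : ℝ, 0 < l → μ {x | l < ‖residual M p f x‖} ≤ C *
      (ENNReal.ofReal (l ^ (-p.toReal)) *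
        ∫⁻ x in {x | 1 / 2 * l < ‖f x‖}, ENNReal.ofReal (‖f x‖ ^ p.toReal) ∂μ +
      ENNReal.ofReal (l ^ (-s.toReal)) *
        ∫⁻ x in {x | ‖f x‖ ≤ 1 / 2 * l}, ENNReal.ofReal (‖f x‖ ^ s.toReal) ∂μ) := by
  have hs0 : s ≠ 0 := (zero_lt_one.trans (hp1.trans hps)).ne'
  obtain ⟨K, hK⟩ := exists_residual_level_comparison M hp1 hp
  obtain ⟨W, hW⟩ := exists_residual_weak_type hs0 hs hw
  have hP := one_lt_toReal hp1 hp
  have hPs : p.toReal < s.toReal := (ENNReal.toReal_lt_toReal hp hs).2 hps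
  set P := p.toReal
  set Q := s.toReal
  set c : ℝ≥0 := (P * (1 / P + 1 / (Q - P))).toNNReal with hc
  set α : ℝ≥0 := ((1 / 2 : ℝ) ^ (-Q)).toNNReal with hα
  set β : ℝ≥0 := ((1 / 2 : ℝ) ^ (P - Q)).toNNReal with hβ
  -- The summand `1` keeps the constant nonzero, so that the bound is trivial when the moment `I` is
  -- infinite.
  refine ⟨1 + K + (α + K * c * β) * W, fun f l hl ↦ ?_⟩
  set S : Set X := {x | 1 / 2 * l < ‖f x‖} with hS
  have mS : MeasurableSet S := measurableSet_lt measurable_const (measurable_norm_lp f)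
  have hSc : Sᶜ = {x | ‖f x‖ ≤ 1 / 2 * l} := by ext x; simp [hS]
  rw [← hSc]
  obtain ⟨g, hg⟩ := exists_lp_eq_indicator f mS.compl
  have hgi := lintegral_indicator_rpow mS.compl hg (by linarith : 0 < Q)
  set I := ∫⁻ x in Sᶜ, ENNReal.ofReal (‖f x‖ ^ Q) ∂μ with hI
  set J := ∫⁻ x in S, ENNReal.ofReal (‖f x‖ ^ P) ∂μ with hJ
  rcases eq_or_ne I ∞ with hItop | hIfin
  · rw [hItop, ENNReal.mul_top (by simp; positivity), add_top, ENNReal.mul_top (by simp)]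
    exact le_top
  have hgm : MemLp g s μ := memLp_of_lintegral_lt_top hs0 hs (hgi ▸ hIfin.lt_top)
  have hk := hW g hgm
  rw [hgi] at hk
  have h1 := hK f g S mS hg l hl
  have h2 := hk (1 / 2 * l) (by positivity)
  have h3 : ∫⁻ x in S ∩ {x | ‖residual M p g x‖ ≤ 2 * ‖residual M p f x‖ ∧
      ‖f x‖ < ‖residual M p g x‖}, ENNReal.ofReal (‖residual M p g x‖ ^ P) ∂μ ≤
      c * (β * ENNReal.ofReal (l ^ (P - Q)) * (W * I)) := by
    have h4 := setLIntegral_rpow_le_of_weak_of_lt (measurable_norm_lp (residual M p g))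
      (fun _ ↦ norm_nonneg _) (by linarith : 0 < P) hPs (by positivity : 0 < 1 / 2 * l) hk
    rw [ofReal_mul_rpow (by norm_num) hl.le] at h4
    refine (lintegral_mono_set fun x hx ↦ ?_).trans h4
    -- On this part of `S` one has `l / 2 < ‖f x‖ < ‖residual M p g x‖`, so only high levels of the
    -- residual enter, as `p < s` requires.
    exact lt_trans hx.1 hx.2.2
  rw [ofReal_mul_rpow (by norm_num) hl.le] at h2
  have h5 : ENNReal.ofReal (l ^ (-P)) * ENNReal.ofReal (l ^ (P - Q)) = ENNReal.ofReal (l ^ (-Q)) :=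
    ofReal_rpow_mul_ofReal_rpow hl (by ring)
  calc μ {x | l < ‖residual M p f x‖}
      ≤ α * ENNReal.ofReal (l ^ (-Q)) * (W * I) + ENNReal.ofReal (l ^ (-P)) *
        (K * (J + c * (β * ENNReal.ofReal (l ^ (P - Q)) * (W * I)))) := by
        refine h1.trans ?_
        gcongr
        exact h2
    _ = K * (ENNReal.ofReal (l ^ (-P)) * J) +
        (α + K * c * β) * W * (ENNReal.ofReal (l ^ (-Q)) * I) := by
        rw [← h5]; ring
    _ ≤ (1 + K + (α + K * c * β) * W) * (ENNReal.ofReal (l ^ (-P)) * J) +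
        (1 + K + (α + K * c * β) * W) * (ENNReal.ofReal (l ^ (-Q)) * I) := by
        gcongr
        · exact le_add_right (le_add_left le_rfl)
        · exact le_add_left le_rfl
    _ = _ := by push_cast; ring

/-- The distribution function of the residual when `ℜ_p` is bounded on `L^∞`. -/
theorem exists_residual_level_bound_of_top [FiniteDimensional ℝ V] {M : Submodule ℝ (Lp V 2 μ)}
    (hp1 : 1 < p) (hp : p ≠ ∞) (hw : WeakType (lpProj M p) ∞) :
    ∃ δ : ℝ, 0 < δ ∧ ∃ C : ℝ≥0, ∀ f : Lp V p μ, ∀ l : ℝ, 0 < l →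
      μ {x | l < ‖residual M p f x‖} ≤ C * (ENNReal.ofReal (l ^ (-p.toReal)) *
        ∫⁻ x in {x | δ * l < ‖f x‖}, ENNReal.ofReal (‖f x‖ ^ p.toReal) ∂μ) := by
  obtain ⟨K, hK⟩ := exists_residual_level_comparison M hp1 hp
  obtain ⟨W, hW⟩ := hw
  have hP := one_lt_toReal hp1 hp
  set P := p.toReal
  -- Since `‖g‖ ≤ δ * l`, this choice gives a residual of `g` of size at most `(1 + W) * δ * l = l /
  -- 2`.
  set δ : ℝ := 1 / (2 * (1 + W)) with hδ
  have hδpos : 0 < δ := by positivity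
  have hδW : (1 + W) * δ = 1 / 2 := by rw [hδ]; field_simp
  set β : ℝ≥0 := ((1 + W : ℝ) ^ P).toNNReal with hβ
  refine ⟨δ, hδpos, K * (1 + β), fun f l hl ↦ ?_⟩
  set S : Set X := {x | δ * l < ‖f x‖} with hS
  have mS : MeasurableSet S := measurableSet_lt measurable_const (measurable_norm_lp f)
  obtain ⟨g, hg⟩ := exists_lp_eq_indicator f mS.compl
  have hgb : ∀ᵐ x ∂μ, ‖g x‖ ≤ δ * l := by
    filter_upwards [hg] with x hx
    rw [hx]
    by_cases h : x ∈ S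
    · rw [Set.indicator_of_notMem (by simpa using h), norm_zero]; positivity
    · rw [Set.indicator_of_mem (by simpa using h)]
      exact not_lt.1 h
  have hRb : ∀ᵐ x ∂μ, ‖lpProj M p g x‖ ≤ W * (δ * l) := by
    have h1 := hW g (memLp_top_of_bound (Lp.memLp g).1 _ hgb)
    rw [if_pos rfl] at h1
    have h2 : eLpNorm g ∞ μ ≤ ENNReal.ofReal (δ * l) := by
      rw [eLpNorm_exponent_top]
      exact eLpNormEssSup_le_of_ae_bound hgb
    have h3 : eLpNorm (lpProj M p g) ∞ μ ≤ ENNReal.ofReal (W * (δ * l)) := by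
      refine h1.trans ?_
      rw [ENNReal.ofReal_mul W.coe_nonneg, ENNReal.ofReal_coe_nnreal]
      gcongr
    rw [eLpNorm_exponent_top] at h3
    filter_upwards [ae_le_eLpNormEssSup (f := lpProj M p g) (μ := μ)] with x hx
    have h4 := hx.trans h3
    rw [← ofReal_norm] at h4
    exact (ENNReal.ofReal_le_ofReal_iff (by positivity)).1 h4
  have hkb : ∀ᵐ x ∂μ, ‖residual M p g x‖ ≤ 1 / 2 * l := by
    filter_upwards [hgb, hRb, coeFn_residual M g] with x h1 h2 h3
    rw [h3, ← hδW]
    have := norm_sub_le (g x) (lpProj M p g x)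
    linarith
  have h1 := hK f g S mS hg l hl
  have h2 : μ {x | 1 / 2 * l < ‖residual M p g x‖} = 0 := by
    rw [measure_eq_zero_iff_ae_notMem]
    filter_upwards [hkb] with x hx using not_lt.2 hx
  have h3 : ∫⁻ x in S ∩ {x | ‖residual M p g x‖ ≤ 2 * ‖residual M p f x‖ ∧
      ‖f x‖ < ‖residual M p g x‖}, ENNReal.ofReal (‖residual M p g x‖ ^ P) ∂μ ≤
      β * ∫⁻ x in S, ENNReal.ofReal (‖f x‖ ^ P) ∂μ := by
    refine (lintegral_mono_set Set.inter_subset_left).trans ?_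
    rw [← lintegral_const_mul' _ _ ENNReal.coe_ne_top]
    refine lintegral_mono_ae ?_
    filter_upwards [ae_restrict_of_ae hkb, ae_restrict_mem mS] with x hx hxS
    -- On `S` the uniform bound `(1 + W) * δ * l` is itself at most `(1 + W) * ‖f x‖`.
    have h4 : ‖residual M p g x‖ ≤ (1 + W) * ‖f x‖ := by
      refine hx.trans ?_
      rw [← hδW, mul_assoc]
      gcongr
      exact le_of_lt hxS
    have h5 : ‖residual M p g x‖ ^ P ≤ (1 + W : ℝ) ^ P * ‖f x‖ ^ P := by
      rw [← Real.mul_rpow (by positivity) (norm_nonneg _)]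
      exact Real.rpow_le_rpow (norm_nonneg _) h4 (by linarith)
    refine (ENNReal.ofReal_le_ofReal h5).trans (le_of_eq ?_)
    rw [ENNReal.ofReal_mul (by positivity)]
    rfl
  rw [h2, zero_add] at h1
  refine h1.trans ?_
  calc _ ≤ ENNReal.ofReal (l ^ (-P)) * (K * (∫⁻ x in S, ENNReal.ofReal (‖f x‖ ^ P) ∂μ +
        β * ∫⁻ x in S, ENNReal.ofReal (‖f x‖ ^ P) ∂μ)) := by gcongr
    _ = _ := by push_cast; ring

/-- The distribution function of the residual when `ℜ_p` has weak type at an exponent `s < p`. -/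
theorem exists_residual_level_bound_of_gt [FiniteDimensional ℝ V] {M : Submodule ℝ (Lp V 2 μ)}
    (hp1 : 1 < p) (hp : p ≠ ∞) {s : ℝ≥0∞} (hs0 : s ≠ 0) (hsp : s < p)
    (hw : WeakType (lpProj M p) s) :
    ∃ δ : ℝ, 0 < δ ∧ ∃ C : ℝ≥0, ∀ f : Lp V p μ, ∀ l : ℝ, 0 < l →
      μ {x | l < ‖residual M p f x‖} ≤ C * (ENNReal.ofReal (l ^ (-s.toReal)) *
        ∫⁻ x in {x | δ * l < ‖f x‖}, ENNReal.ofReal (‖f x‖ ^ s.toReal) ∂μ +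
      ENNReal.ofReal (l ^ (-p.toReal)) *
        ∫⁻ x in {x | ‖f x‖ ≤ δ * l}, ENNReal.ofReal (‖f x‖ ^ p.toReal) ∂μ) := by
  have hs : s ≠ ∞ := (hsp.trans_le le_top).ne
  have hp0 : p ≠ 0 := (zero_lt_one.trans hp1).ne'
  obtain ⟨K, hK⟩ := exists_residual_level_comparison M hp1 hp
  obtain ⟨W, hW⟩ := exists_residual_weak_type hs0 hs hw
  have hP := one_lt_toReal hp1 hp
  have hsP : s.toReal < p.toReal := (ENNReal.toReal_lt_toReal hs hp).2 hsp
  have hQ : 0 < s.toReal := ENNReal.toReal_pos hs0 hs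
  set P := p.toReal
  set Q := s.toReal
  set c : ℝ≥0 := (P / (P - Q)).toNNReal with hc
  set α : ℝ≥0 := ((1 / 2 : ℝ) ^ (-Q)).toNNReal with hα
  set β : ℝ≥0 := ((2 : ℝ) ^ (P - Q)).toNNReal with hβ
  set B : ℝ≥0 := (α + K * c * β) * W with hB
  -- `B` will be the total factor of the `s`-th moment of `g`; `δ` is chosen so that `B * δ ^ Q ≤ 1
  -- / 2`, which permits the absorption of `m`.
  set δ : ℝ := (1 / (2 * (B + 1)) : ℝ) ^ (1 / Q) with hδ
  have hδpos : 0 < δ := by positivity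
  have hδB : (B : ℝ≥0∞) * ENNReal.ofReal (δ ^ Q) ≤ 2⁻¹ := by
    have h1 : δ ^ Q = 1 / (2 * (B + 1)) := by
      rw [hδ, ← Real.rpow_mul (by positivity), one_div_mul_cancel hQ.ne', Real.rpow_one]
    have h2 : (B : ℝ) * (1 / (2 * (B + 1))) ≤ 2⁻¹ := by
      rw [mul_one_div, div_le_iff₀ (by positivity)]
      linarith
    rw [h1, ← ENNReal.ofReal_coe_nnreal, ← ENNReal.ofReal_mul B.coe_nonneg]
    refine (ENNReal.ofReal_le_ofReal h2).trans (le_of_eq ?_)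
    rw [ENNReal.ofReal_inv_of_pos (by norm_num)]; simp
  refine ⟨δ, hδpos, 2 * (1 + K + B), fun f l hl ↦ ?_⟩
  set h := residual M p f with hh
  set m := μ {x | l < ‖h x‖} with hm
  set D : Set X := {x | δ * l < ‖f x‖} with hD
  have mD : MeasurableSet D := measurableSet_lt measurable_const (measurable_norm_lp f)
  have hDc : {x | ‖f x‖ ≤ δ * l} = Dᶜ := by ext x; simp [hD]
  have mH : MeasurableSet {x | l < ‖h x‖} := measurableSet_lt measurable_const (measurable_norm_lp h)
  rw [hDc]
  -- Removing `{l < ‖h‖}` from `S` forces `‖h‖ ≤ l` there, hence a residual of `g` at most `2 * l`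
  -- on the set where it is at most `2 * ‖h‖`. The price is that `g` keeps `f` on `{l < ‖h‖}`.
  set S : Set X := (D ∪ {x | l < ‖h x‖})ᶜ with hS
  have mS : MeasurableSet S := (mD.union mH).compl
  obtain ⟨g, hg⟩ := exists_lp_eq_indicator f mS.compl
  have hgi := lintegral_indicator_rpow mS.compl hg hQ
  set I := ∫⁻ x in D, ENNReal.ofReal (‖f x‖ ^ Q) ∂μ with hI
  set J := ∫⁻ x in Dᶜ, ENNReal.ofReal (‖f x‖ ^ P) ∂μ with hJ
  rcases eq_or_ne I ∞ with hItop | hIfin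
  · rw [hItop, ENNReal.mul_top (by simp; positivity), top_add, ENNReal.mul_top (by simp)]
    exact le_top
  -- Finiteness of `m`, from `h ∈ L^p`, is what makes the later subtraction of `2⁻¹ * m` legitimate.
  have hmfin : m ≠ ∞ := by
    refine ne_top_of_le_ne_top ?_ (measure_lt_le_ofReal_rpow_mul (μ := μ)
      (measurable_norm_lp h) (by linarith : 0 < P) hl Set.univ MeasurableSet.univ |>.trans_eq' ?_)
    · rw [Measure.restrict_univ]
      refine ENNReal.mul_ne_top ENNReal.ofReal_ne_top ?_
      have := lintegral_rpow_enorm_lt_top_of_eLpNorm_lt_top hp0 hp (Lp.memLp h).2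
      simpa only [enorm_rpow_eq_ofReal _ ENNReal.toReal_nonneg] using this.ne
    · rw [Set.inter_univ]
  have hgle : ∫⁻ x, ENNReal.ofReal (‖g x‖ ^ Q) ∂μ ≤
      I + ENNReal.ofReal (δ ^ Q) * ENNReal.ofReal (l ^ Q) * m := by
    have e1 : Sᶜ = D ∪ ({x | l < ‖h x‖} \ D) := by rw [hS, compl_compl, Set.union_sdiff_self]
    rw [hgi, e1]
    refine (lintegral_union_le _ _ _).trans ?_
    gcongr
    -- Off `D` one has `‖f‖ ≤ δ * l`, so the extra piece of `g` costs at most `(δ * l) ^ Q * m`.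
    calc ∫⁻ x in {x | l < ‖h x‖} \ D, ENNReal.ofReal (‖f x‖ ^ Q) ∂μ
        ≤ ∫⁻ _ in {x | l < ‖h x‖} \ D, ENNReal.ofReal ((δ * l) ^ Q) ∂μ := by
          refine setLIntegral_mono' (mH.diff mD) fun x hx ↦ ENNReal.ofReal_le_ofReal ?_
          exact Real.rpow_le_rpow (norm_nonneg _) (not_lt.1 hx.2) hQ.le
      _ = ENNReal.ofReal ((δ * l) ^ Q) * μ ({x | l < ‖h x‖} \ D) := setLIntegral_const _ _
      _ ≤ _ := by
          rw [ofReal_mul_rpow hδpos.le hl.le]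
          gcongr
          exact measure_mono Set.sdiff_subset
  have hgfin : ∫⁻ x, ENNReal.ofReal (‖g x‖ ^ Q) ∂μ < ∞ :=
    hgle.trans_lt (ENNReal.add_lt_top.2 ⟨hIfin.lt_top, (ENNReal.mul_ne_top (ENNReal.mul_ne_top
      ENNReal.ofReal_ne_top ENNReal.ofReal_ne_top) hmfin).lt_top⟩)
  have hk := hW g (memLp_of_lintegral_lt_top hs0 hs hgfin)
  set G := ∫⁻ x, ENNReal.ofReal (‖g x‖ ^ Q) ∂μ with hG
  have h1 := hK f g S mS hg l hl
  have h2 := hk (1 / 2 * l) (by positivity)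
  rw [ofReal_mul_rpow (by norm_num) hl.le] at h2
  have h3 : ∫⁻ x in S ∩ {x | ‖residual M p g x‖ ≤ 2 * ‖residual M p f x‖ ∧
      ‖f x‖ < ‖residual M p g x‖}, ENNReal.ofReal (‖residual M p g x‖ ^ P) ∂μ ≤
      c * (β * ENNReal.ofReal (l ^ (P - Q)) * (W * G)) := by
    have h4 := setLIntegral_rpow_le_of_weak_of_gt (measurable_norm_lp (residual M p g))
      (fun _ ↦ norm_nonneg _) (by linarith : 0 < P) hsP (by positivity : 0 < 2 * l) hk
    rw [ofReal_mul_rpow (by norm_num) hl.le] at h4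
    refine (lintegral_mono_set fun x hx ↦ ?_).trans h4
    have h5 : ‖h x‖ ≤ l := not_lt.1 fun hcon ↦ hx.1 (Or.inr hcon)
    change ‖residual M p g x‖ ≤ 2 * l
    linarith [hx.2.1]
  have h4 : ∫⁻ x in S, ENNReal.ofReal (‖f x‖ ^ P) ∂μ ≤ J :=
    lintegral_mono_set fun x hx hxD ↦ hx (Or.inl hxD)
  have h5 : ENNReal.ofReal (l ^ (-P)) * ENNReal.ofReal (l ^ (P - Q)) = ENNReal.ofReal (l ^ (-Q)) :=
    ofReal_rpow_mul_ofReal_rpow hl (by ring)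
  have h6 : ENNReal.ofReal (l ^ (-Q)) * ENNReal.ofReal (l ^ Q) = 1 := by
    rw [ofReal_rpow_mul_ofReal_rpow hl (neg_add_cancel Q)]; simp
  have h7 : m ≤ (K * (ENNReal.ofReal (l ^ (-P)) * J) + B * (ENNReal.ofReal (l ^ (-Q)) * I)) +
      2⁻¹ * m := by
    calc m ≤ α * ENNReal.ofReal (l ^ (-Q)) * (W * G) + ENNReal.ofReal (l ^ (-P)) *
          (K * (J + c * (β * ENNReal.ofReal (l ^ (P - Q)) * (W * G)))) := by
          refine h1.trans ?_
          gcongr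
          exact h2
      _ = K * (ENNReal.ofReal (l ^ (-P)) * J) + B * (ENNReal.ofReal (l ^ (-Q)) * G) := by
          rw [← h5, hB]; push_cast; ring
      _ ≤ K * (ENNReal.ofReal (l ^ (-P)) * J) + B * (ENNReal.ofReal (l ^ (-Q)) *
          (I + ENNReal.ofReal (δ ^ Q) * ENNReal.ofReal (l ^ Q) * m)) := by gcongr
      _ = (K * (ENNReal.ofReal (l ^ (-P)) * J) + B * (ENNReal.ofReal (l ^ (-Q)) * I)) +
          (ENNReal.ofReal (l ^ (-Q)) * ENNReal.ofReal (l ^ Q)) *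
            ((B * ENNReal.ofReal (δ ^ Q)) * m) := by ring
      _ ≤ _ := by rw [h6, one_mul]; gcongr
  have h8 : m ≤ 2 * (K * (ENNReal.ofReal (l ^ (-P)) * J) + B * (ENNReal.ofReal (l ^ (-Q)) * I)) := by
    have h9 : 2⁻¹ * m + 2⁻¹ * m = m := by
      rw [← add_mul, ENNReal.inv_two_add_inv_two, one_mul]
    have h10 : 2⁻¹ * m ≤ K * (ENNReal.ofReal (l ^ (-P)) * J) +
        B * (ENNReal.ofReal (l ^ (-Q)) * I) := by
      refine (ENNReal.add_le_add_iff_right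
        (ENNReal.mul_ne_top (by simp) hmfin : 2⁻¹ * m ≠ ∞)).1 ?_
      rw [h9]; exact h7
    calc m = 2 * (2⁻¹ * m) := by
          rw [← mul_assoc, ENNReal.mul_inv_cancel (by simp) (by simp), one_mul]
      _ ≤ _ := by gcongr
  calc m ≤ _ := h8
    _ ≤ 2 * ((1 + K + B) * (ENNReal.ofReal (l ^ (-P)) * J) +
        (1 + K + B) * (ENNReal.ofReal (l ^ (-Q)) * I)) := by
        gcongr
        · exact le_add_right (le_add_left le_rfl)
        · exact le_add_left le_rfl
    _ = _ := by push_cast; ring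

theorem exists_lpProj_rpow_le [FiniteDimensional ℝ V] {M : Submodule ℝ (Lp V 2 μ)} {r : ℝ≥0}
    (hr : 1 ≤ r) {C : ℝ≥0} {f : Lp V p μ}
    (h : ∫⁻ x, ENNReal.ofReal (‖residual M p f x‖ ^ (r : ℝ)) ∂μ ≤
      C * ∫⁻ x, ENNReal.ofReal (‖f x‖ ^ (r : ℝ)) ∂μ) :
    ∫⁻ x, ‖lpProj M p f x‖ₑ ^ (r : ℝ) ∂μ ≤
      ((2 ^ ((r : ℝ) - 1) * (1 + C) : ℝ≥0) : ℝ≥0∞) * ∫⁻ x, ‖f x‖ₑ ^ (r : ℝ) ∂μ := by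
  simp only [← enorm_rpow_eq_ofReal _ r.coe_nonneg] at h
  have hm : Measurable fun x ↦ ‖f x‖ₑ ^ (r : ℝ) :=
    ((Lp.stronglyMeasurable f).enorm).pow_const _
  have h2 : (2 : ℝ≥0∞) ^ ((r : ℝ) - 1) ≠ ∞ :=
    ENNReal.rpow_ne_top_of_nonneg (by simpa using hr) (by simp)
  calc ∫⁻ x, ‖lpProj M p f x‖ₑ ^ (r : ℝ) ∂μ
      ≤ ∫⁻ x, 2 ^ ((r : ℝ) - 1) * (‖f x‖ₑ ^ (r : ℝ) + ‖residual M p f x‖ₑ ^ (r : ℝ)) ∂μ := by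
        refine lintegral_mono_ae ?_
        filter_upwards [coeFn_residual M f] with x hx
        have h1 : lpProj M p f x = f x - residual M p f x := by rw [hx]; abel
        rw [h1]
        refine (ENNReal.rpow_le_rpow enorm_sub_le r.coe_nonneg).trans ?_
        exact ENNReal.rpow_add_le_mul_rpow_add_rpow _ _ (by simpa using hr)
    _ = 2 ^ ((r : ℝ) - 1) * (∫⁻ x, ‖f x‖ₑ ^ (r : ℝ) ∂μ +
        ∫⁻ x, ‖residual M p f x‖ₑ ^ (r : ℝ) ∂μ) := by
        rw [lintegral_const_mul' _ _ h2, lintegral_add_left hm]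
    _ ≤ 2 ^ ((r : ℝ) - 1) * (∫⁻ x, ‖f x‖ₑ ^ (r : ℝ) ∂μ + C * ∫⁻ x, ‖f x‖ₑ ^ (r : ℝ) ∂μ) := by
        gcongr
    _ = _ := by
        push_cast [ENNReal.coe_rpow_of_nonneg (2 : ℝ≥0) (by simpa using hr : 0 ≤ (r : ℝ) - 1)]
        ring

theorem lintegral_residual_le [FiniteDimensional ℝ V] (M : Submodule ℝ (Lp V 2 μ)) (hp1 : 1 < p)
    (hp : p ≠ ∞) (f : Lp V p μ) :
    ∫⁻ x, ENNReal.ofReal (‖residual M p f x‖ ^ p.toReal) ∂μ ≤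
      ∫⁻ x, ENNReal.ofReal (‖f x‖ ^ p.toReal) ∂μ := by
  have h1 := (isNearest_lpProj M hp1 hp f).2 0 (lpPlus M p).zero_mem
  rw [sub_zero] at h1
  have h2 : ‖residual M p f‖ ^ p.toReal ≤ ‖f‖ ^ p.toReal :=
    Real.rpow_le_rpow (norm_nonneg _) h1 ENNReal.toReal_nonneg
  rw [norm_rpow_eq_integral hp, norm_rpow_eq_integral hp] at h2
  have h3 : ∀ u : Lp V p μ, ∫⁻ x, ENNReal.ofReal (‖u x‖ ^ p.toReal) ∂μ =
      ENNReal.ofReal (∫ x, ‖u x‖ ^ p.toReal ∂μ) := fun u ↦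
    (ofReal_integral_eq_lintegral_ofReal (integrable_norm_rpow hp u)
      (Filter.Eventually.of_forall fun x ↦ Real.rpow_nonneg (norm_nonneg _) _)).symm
  rw [h3, h3]
  exact ENNReal.ofReal_le_ofReal h2

end LpProjection

/-! ### The interpolation theorem -/

theorem theorem1p1
    {X : Type*} [MeasurableSpace X] (μ : Measure X) [SigmaFinite μ]
    {V : Type*} [NormedAddCommGroup V] [InnerProductSpace ℝ V] [FiniteDimensional ℝ V]
    (M : Submodule ℝ (Lp V 2 μ)) (hM : IsClosed (M : Set (Lp V 2 μ)))
    (s₁ sinf : ℝ≥0∞) (hs₁ : 1 ≤ s₁) (hs₁2 : s₁ < 2) (hsinf : 2 < sinf)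
    (hext : ∀ (s : ℝ≥0∞) [Fact (1 ≤ s)], s₁ < s → s < sinf →
      LpProjection.ExtendsToLp (LpProjection.l2Proj M hM) s)
    (p : ℝ≥0∞) [Fact (1 ≤ p)] (hp₁ : s₁ < p) (hp : p < sinf)
    (r₁ r₂ : ℝ≥0∞) (hr₁ : s₁ ≤ r₁) (hr : r₁ < r₂) (hr₂ : r₂ ≤ sinf)
    (hweak₁ : LpProjection.WeakType (LpProjection.lpProj M p) r₁)
    (hweak₂ : LpProjection.WeakType (LpProjection.lpProj M p) r₂) :
    ∀ r : ℝ≥0, r₁ < r → r < r₂ →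
      ∃ C : ℝ≥0, ∀ f : Lp V p μ, MemLp f r μ →
        ∫⁻ x, ‖LpProjection.lpProj M p f x‖ₑ ^ (r : ℝ) ∂μ
          ≤ C * ∫⁻ x, ‖f x‖ₑ ^ (r : ℝ) ∂μ := by
  intro r hr1 hr2
  have hp1 : 1 < p := hs₁.trans_lt hp₁
  have hpt : p ≠ ∞ := (hp.trans_le le_top).ne
  have hr₁1 : 1 ≤ r₁ := hs₁.trans hr₁
  have hr1' : 1 < r := by exact_mod_cast hr₁1.trans_lt hr1
  have hr0 : (0 : ℝ) < r := by exact_mod_cast zero_lt_one.trans hr1'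
  have hrt : ((r : ℝ≥0∞)).toReal = (r : ℝ) := ENNReal.coe_toReal r
  suffices H : ∃ C : ℝ≥0, ∀ f : Lp V p μ,
      ∫⁻ x, ENNReal.ofReal (‖LpProjection.residual M p f x‖ ^ (r : ℝ)) ∂μ ≤
        C * ∫⁻ x, ENNReal.ofReal (‖f x‖ ^ (r : ℝ)) ∂μ by
    obtain ⟨C, hC⟩ := H
    exact ⟨_, fun f _ ↦ LpProjection.exists_lpProj_rpow_le hr1'.le (hC f)⟩
  rcases lt_trichotomy (r : ℝ≥0∞) p with hrp | hrp | hrp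
  · have h1 : r₁.toReal < r := by
      rw [← hrt]; exact (ENNReal.toReal_lt_toReal (hr1.trans_le le_top).ne ENNReal.coe_ne_top).2 hr1
    have h2 : (r : ℝ) < p.toReal := by
      rw [← hrt]; exact (ENNReal.toReal_lt_toReal ENNReal.coe_ne_top hpt).2 hrp
    obtain ⟨δ, hδ, C, hC⟩ := LpProjection.exists_residual_level_bound_of_gt hp1 hpt
      (zero_lt_one.trans_le hr₁1).ne' (hr1.trans hrp) hweak₁
    obtain ⟨C', hC'⟩ := LpProjection.exists_lintegral_rpow_le_of_level_bound (μ := μ)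
      h1 h2 hr0 hδ C
    exact ⟨C', fun f ↦ hC' _ _ (LpProjection.measurable_norm_lp f) (fun _ ↦ norm_nonneg _)
      (LpProjection.measurable_norm_lp _) (fun _ ↦ norm_nonneg _) (hC f)⟩
  · refine ⟨1, fun f ↦ ?_⟩
    have := LpProjection.lintegral_residual_le M hp1 hpt f
    rw [show p.toReal = r by rw [← hrp, hrt]] at this
    simpa using this
  · have h1 : p.toReal < r := by
      rw [← hrt]; exact (ENNReal.toReal_lt_toReal hpt ENNReal.coe_ne_top).2 hrp
    by_cases hr₂t : r₂ = ∞
    · subst hr₂t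
      obtain ⟨δ, hδ, C, hC⟩ := LpProjection.exists_residual_level_bound_of_top hp1 hpt hweak₂
      -- The level bound has no low part when `r₂ = ∞`; any order above `r`, here `r + 1`, may be
      -- used for the superfluous second term.
      obtain ⟨C', hC'⟩ := LpProjection.exists_lintegral_rpow_le_of_level_bound (μ := μ)
        h1 (lt_add_one (r : ℝ)) hr0 hδ C
      refine ⟨C', fun f ↦ hC' _ _ (LpProjection.measurable_norm_lp f) (fun _ ↦ norm_nonneg _)
        (LpProjection.measurable_norm_lp _) (fun _ ↦ norm_nonneg _) fun t ht ↦ ?_⟩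
      refine (hC f t ht).trans ?_
      gcongr
      exact le_self_add
    · have h2 : (r : ℝ) < r₂.toReal := by
        rw [← hrt]; exact (ENNReal.toReal_lt_toReal ENNReal.coe_ne_top hr₂t).2 hr2
      obtain ⟨C, hC⟩ := LpProjection.exists_residual_level_bound_of_lt hp1 hpt hr₂t
        (hrp.trans hr2) hweak₂
      obtain ⟨C', hC'⟩ := LpProjection.exists_lintegral_rpow_le_of_level_bound (μ := μ)
        h1 h2 hr0 one_half_pos C
      exact ⟨C', fun f ↦ hC' _ _ (LpProjection.measurable_norm_lp f) (fun _ ↦ norm_nonneg _)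
        (LpProjection.measurable_norm_lp _) (fun _ ↦ norm_nonneg _) (hC f)⟩
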